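/- Let $\mathcal H=\ell^2(\mathbb Z^2)\otimes\mathbb C^N$ with $N\in\mathbb N$, and for $A\in\mathcal B(\mathcal H)$ let $A_{xy}=\langle\delta_x,A\delta_y\rangle$ denote its $N\times N$ matrix elements. Call $A$ \emph{local} if for all sufficiently large $\alpha\in\mathbb N$ there is $C_\alpha<\infty$ with $\|A_{xy}\|\le C_\alpha(1+\|x-y\|)^{-\alpha}$ for all $x,y\in\mathbb Z^2$, and \emph{weakly local} if there is $\nu\in\mathbb N$ such that for all sufficiently large $\mu\in\mathbb N$ there is $C_\mu<\infty$ with $\|A_{xy}\|\le C_\mu(1+\|x-y\|)^{-\mu}(1+\|x\|)^{\nu}$ for all $x,y\in\mathbb Z^2$. Let $H$ be a self-adjoint local operator on $\mathcal H$ and let $\Delta\subset\mathbb R$ be an interval which is a mobility gap for $H$, that is: (1) $f(H)$ is weakly local, with $\nu$ and $C_\mu$ independent of $f$, for all Borel functions $f$ with $\|f\|_\infty\le1$ that are constant on $(-\infty,\inf\Delta]$ and constant on $[\sup\Delta,\infty)$; and (2) every eigenvalue of $H$ in $\Delta$ has finite multiplicity. Let $U=\exp(\mathrm i\arg(X_1+\mathrm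 iX_2))$ be the flux insertion operator, where $X_1,X_2$ are the position operators and $\arg 0:=0$. Let $Q=\chi_S(H)$ be the spectral projection of $H$ onto any Borel set $S\subseteq\Delta$, and put $$\mathbb QU:=QUQ+Q^\perp .$$ Then $\mathbb QU$ is a Fredholm operator and $$\operatorname{index}\,\mathbb QU:=\dim\ker \mathbb QU-\dim\ker(\mathbb QU)^*=0 .$$ Moreover, let $\Theta$ be a Fermionic time-reversal symmetry, i.e. a conjugate-linear map on $\mathcal H$ with $\langle\Theta\psi,\Theta\varphi\rangle=\langle\varphi,\psi\rangle$ for all $\psi,\varphi\in\mathcal H$, $\Theta^2=-\mathbb 1$ and $[\Theta,X_1]=[\Theta,X_2]=0$. If $H$ is time-reversal invariant, $[H,\Theta]=0$, then $\mathbb QU$ is $\Theta$-odd, i.e. $\mathbb QU=-\Theta(\mathbb QU)^*\Theta$, and its $\mathbb Z_2$-valued index also vanishes: $$\operatorname{index}_2\,\mathbb QU:=\dim\ker\mathbb QU \bmod 2=0 .$$ -/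

import Mathlib

open MeasureTheory Filter Topology
open scoped InnerProductSpace CompactlySupported

noncomputable section

/-! ### Bounded Borel functional calculus of a bounded self-adjoint operator -/

section BorelFunctionalCalculus

variable {E : Type*} [NormedAddCommGroup E] [InnerProductSpace ℂ E] [CompleteSpace E]

/-- The positive linear functional `g ↦ ⟨ψ, g(H) ψ⟩` on `C_c(ℝ, ℝ)`, where `g(H)` is given by the
continuous functional calculus of the bounded self-adjoint operator `H`. -/
def spectralFunctional (H : E →L[ℂ] E) (ψ : E) : C_c(ℝ, ℝ) →ₚ[ℝ] ℝ :=
  PositiveLinearMap.mk₀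
    { toFun := fun g => (⟪ψ, cfc (g : ℝ → ℝ) H ψ⟫_ℂ).re
      map_add' := fun g h => by
        have : cfc (⇑(g + h)) H = cfc (g : ℝ → ℝ) H + cfc (h : ℝ → ℝ) H := by
          rw [← cfc_add (a := H) (g : ℝ → ℝ) (h : ℝ → ℝ) g.continuous.continuousOn
            h.continuous.continuousOn]
          rfl
        rw [this]; simp
      map_smul' := fun c g => by
        have : cfc (⇑(c • g)) H = c • cfc (g : ℝ → ℝ) H := by
          rw [← cfc_smul (a := H) c (g : ℝ → ℝ) g.continuous.continuousOn]
          rfl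
        rw [this]
        simp [inner_smul_right_eq_smul] }
    (fun g hg => by
      have h1 : (0 : E →L[ℂ] E) ≤ cfc (g : ℝ → ℝ) H := cfc_nonneg (fun x _ => hg x)
      rw [ContinuousLinearMap.nonneg_iff_isPositive] at h1
      exact h1.re_inner_nonneg_right ψ)

/-- The spectral measure of the self-adjoint operator `H` at the vector `ψ`: the measure on `ℝ`
with `∫ g dμ = ⟨ψ, g(H) ψ⟩` for continuous compactly supported `g`. -/
def spectralMeasure (H : E →L[ℂ] E) (ψ : E) : Measure ℝ :=
  RealRMK.rieszMeasure (spectralFunctional H ψ)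

lemma integral_spectralMeasure (H : E →L[ℂ] E) (ψ : E) (g : C_c(ℝ, ℝ)) :
    ∫ t, g t ∂(spectralMeasure H ψ) = (⟪ψ, cfc (g : ℝ → ℝ) H ψ⟫_ℂ).re :=
  RealRMK.integral_rieszMeasure _ g

instance (H : E →L[ℂ] E) (ψ : E) : (spectralMeasure H ψ).Regular := by
  unfold spectralMeasure; infer_instance

lemma spectralMeasure_univ_le (H : E →L[ℂ] E) (ψ : E) :
    spectralMeasure H ψ Set.univ ≤ ENNReal.ofReal (‖ψ‖ ^ 2) := by
  rw [isOpen_univ.measure_eq_iSup_isCompact]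
  refine iSup₂_le fun K _ => iSup_le fun hK => ?_
  obtain ⟨g, hg1, -, hgc, hg⟩ :=
    exists_continuous_one_zero_of_isCompact (X := ℝ) (t := ∅) hK isClosed_empty (by simp)
  let G : C_c(ℝ, ℝ) := ⟨g, hgc⟩
  refine (RealRMK.rieszMeasure_le_of_eq_one (spectralFunctional H ψ) (f := G)
    (fun x => (hg x).1) hK (fun x hx => hg1 hx)).trans (ENNReal.ofReal_le_ofReal ?_)
  have h2 : ‖cfc (g : ℝ → ℝ) H‖ ≤ 1 := norm_cfc_le zero_le_one fun x _ => by
    rw [Real.norm_eq_abs, abs_of_nonneg (hg x).1]; exact (hg x).2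
  calc (⟪ψ, cfc (g : ℝ → ℝ) H ψ⟫_ℂ).re ≤ ‖⟪ψ, cfc (g : ℝ → ℝ) H ψ⟫_ℂ‖ := Complex.re_le_norm _
    _ ≤ ‖ψ‖ * ‖cfc (g : ℝ → ℝ) H ψ‖ := norm_inner_le_norm _ _
    _ ≤ ‖ψ‖ * (1 * ‖ψ‖) := by gcongr; exact ContinuousLinearMap.le_of_opNorm_le _ h2 _
    _ = ‖ψ‖ ^ 2 := by ring

instance (H : E →L[ℂ] E) (ψ : E) : IsFiniteMeasure (spectralMeasure H ψ) :=
  ⟨(spectralMeasure_univ_le H ψ).trans_lt ENNReal.ofReal_lt_top⟩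

lemma sum_integral_spectralMeasure_eq_zero_of_real (H : E →L[ℂ] E) (s : Finset E) (c : E → ℝ)
    (hc : ∀ A : E →L[ℂ] E, ∑ v ∈ s, c v * (⟪v, A v⟫_ℂ).re = 0)
    (f : ℝ → ℂ) (hf : Measurable f) (C : ℝ) (hfC : ∀ t, ‖f t‖ ≤ C) :
    ∑ v ∈ s, (c v : ℂ) * ∫ t, f t ∂(spectralMeasure H v) = 0 := by
  have hcv : ∀ v, ((c v).toNNReal : ℝ) - ((-c v).toNNReal : ℝ) = c v := fun v => by
    rw [Real.coe_toNNReal', Real.coe_toNNReal']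
    exact max_zero_sub_max_neg_zero_eq_self (c v)
  have key : ∑ v ∈ s, (c v).toNNReal • spectralMeasure H v
      = ∑ v ∈ s, (-c v).toNNReal • spectralMeasure H v := by
    apply Measure.ext_of_integral_eq_on_compactlySupported
    intro g
    have hg : ∀ (μ : Measure ℝ), IsFiniteMeasure μ → Integrable (fun x => g x) μ := fun μ _ =>
      g.continuous.integrable_of_hasCompactSupport g.hasCompactSupport
    rw [integral_finsetSum_measure fun v _ => hg _ inferInstance,
      integral_finsetSum_measure fun v _ => hg _ inferInstance, ← sub_eq_zero, ← Finset.sum_sub_distrib, ← hc (cfc (g : ℝ → ℝ) H)]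
    refine Finset.sum_congr rfl fun v _ => ?_
    rw [integral_smul_nnreal_measure, integral_smul_nnreal_measure, integral_spectralMeasure,
      NNReal.smul_def, NNReal.smul_def, ← sub_smul, hcv, smul_eq_mul]
  have hi : ∀ μ : Measure ℝ, IsFiniteMeasure μ → Integrable f μ := fun μ _ =>
    Integrable.of_bound hf.aestronglyMeasurable C (ae_of_all _ hfC)
  have h2 := congrArg (fun μ => ∫ t, f t ∂μ) key
  rw [integral_finsetSum_measure fun v _ => hi _ inferInstance,
    integral_finsetSum_measure fun v _ => hi _ inferInstance,
    ← sub_eq_zero, ← Finset.sum_sub_distrib] at h2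
  rw [← h2]
  refine Finset.sum_congr rfl fun v _ => ?_
  rw [integral_smul_nnreal_measure, integral_smul_nnreal_measure, NNReal.smul_def,
    NNReal.smul_def, ← sub_smul, hcv, Complex.real_smul]

lemma sum_integral_spectralMeasure_eq_zero (H : E →L[ℂ] E) (s : Finset E) (c : E → ℂ)
    (hc : ∀ A : E →L[ℂ] E, ∑ v ∈ s, c v * ⟪v, A v⟫_ℂ = 0)
    (f : ℝ → ℂ) (hf : Measurable f) (C : ℝ) (hfC : ∀ t, ‖f t‖ ≤ C) :
    ∑ v ∈ s, c v * ∫ t, f t ∂(spectralMeasure H v) = 0 := by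
  have h : ∀ A : E →L[ℂ] E, ∀ v : E,
      ((⟪v, ((2⁻¹ : ℂ) • (A + ContinuousLinearMap.adjoint A)) v⟫_ℂ) : ℂ)
        = ((⟪v, A v⟫_ℂ).re : ℂ) := by
    intro A v
    simp only [smul_apply, add_apply, inner_smul_right,
      inner_add_right, ContinuousLinearMap.adjoint_inner_right]
    rw [← inner_conj_symm (A v) v, Complex.add_conj]
    push_cast
    ring
  have h' : ∀ A : E →L[ℂ] E, ∑ v ∈ s, c v * ((⟪v, A v⟫_ℂ).re : ℂ) = 0 := fun A => by
    rw [← hc ((2⁻¹ : ℂ) • (A + ContinuousLinearMap.adjoint A))]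
    exact Finset.sum_congr rfl fun v _ => by rw [h]
  have h1 := sum_integral_spectralMeasure_eq_zero_of_real H s (fun v => (c v).re) (fun A => by
    simpa using congrArg Complex.re (h' A)) f hf C hfC
  have h2 := sum_integral_spectralMeasure_eq_zero_of_real H s (fun v => (c v).im) (fun A => by
    simpa using congrArg Complex.im (h' A)) f hf C hfC
  have : ∀ v, c v * ∫ t, f t ∂(spectralMeasure H v)
      = ((c v).re : ℂ) * ∫ t, f t ∂(spectralMeasure H v)
        + Complex.I * (((c v).im : ℂ) * ∫ t, f t ∂(spectralMeasure H v)) := fun v => by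
    conv_lhs => rw [← Complex.re_add_im (c v)]
    ring
  simp only [this, Finset.sum_add_distrib, ← Finset.mul_sum, h1, h2, mul_zero, add_zero]

lemma exists_borelFC (H : E →L[ℂ] E)
    (f : ℝ → ℂ) (hf : Measurable f) (C : ℝ) (hfC : ∀ t, ‖f t‖ ≤ C) :
    ∃ A : E →L[ℂ] E, ∀ ψ : E, ⟪ψ, A ψ⟫_ℂ = ∫ t, f t ∂(spectralMeasure H ψ) := by
  have hC : 0 ≤ C := (norm_nonneg _).trans (hfC 0)
  let ω : E →ₗ⋆[ℂ] E →ₗ[ℂ] ((E →L[ℂ] E) →ₗ[ℂ] ℂ) :=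
    LinearMap.mk₂'ₛₗ (starRingEnd ℂ) (RingHom.id ℂ)
      (fun x y => { toFun := fun A => ⟪x, A y⟫_ℂ
                    map_add' := fun A B => by simp
                    map_smul' := fun a A => by simp })
      (fun x y z => by ext A; simp)
      (fun a x y => by ext A; simp [mul_comm])
      (fun x y z => by ext A; simp)
      (fun a x y => by ext A; simp)
  let Ψ : (E →₀ ℂ) →ₗ[ℂ] ((E →L[ℂ] E) →ₗ[ℂ] ℂ) := Finsupp.linearCombination ℂ (fun v => ω v v)
  let Φ : (E →₀ ℂ) →ₗ[ℂ] ℂ :=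
    Finsupp.linearCombination ℂ (fun v => ∫ t, f t ∂(spectralMeasure H v))
  have hk : LinearMap.ker Ψ ≤ LinearMap.ker Φ := by
    intro c hc
    rw [LinearMap.mem_ker] at hc ⊢
    refine sum_integral_spectralMeasure_eq_zero H c.support c (fun A => ?_) f hf C hfC
    have := congrArg (fun l => l A) hc
    simpa [Ψ, Finsupp.linearCombination_apply, Finsupp.sum, ω] using this
  obtain ⟨L, hL⟩ : ∃ L : ((E →L[ℂ] E) →ₗ[ℂ] ℂ) →ₗ[ℂ] ℂ, ∀ c, L (Ψ c) = Φ c := by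
    obtain ⟨L, hL⟩ := LinearMap.exists_extend
      (((LinearMap.ker Ψ).liftQ Φ hk) ∘ₗ Ψ.quotKerEquivRange.symm.toLinearMap)
    refine ⟨L, fun c => ?_⟩
    have h1 := congrArg (fun l => l ⟨Ψ c, c, rfl⟩) hL
    simp only [LinearMap.comp_apply, Submodule.subtype_apply] at h1
    rw [h1]
    have : Ψ.quotKerEquivRange.symm ⟨Ψ c, c, rfl⟩ = Submodule.Quotient.mk c := by
      rw [LinearEquiv.symm_apply_eq]; rfl
    simp [this]
  have hq : ∀ v, L (ω v v) = ∫ t, f t ∂(spectralMeasure H v) := fun v => by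
    have := hL (Finsupp.single v 1)
    simpa [Ψ, Φ] using this
  have hqb : ∀ v, ‖L (ω v v)‖ ≤ C * ‖v‖ ^ 2 := fun v => by
    rw [hq]
    refine (norm_integral_le_of_norm_le_const (ae_of_all _ hfC)).trans ?_
    gcongr
    exact ENNReal.toReal_le_of_le_ofReal (by positivity) (spectralMeasure_univ_le H v)
  have hpol : ∀ x y, L (ω x y) = (L (ω (x + y) (x + y)) - L (ω (x - y) (x - y))
      - Complex.I * L (ω (x + Complex.I • y) (x + Complex.I • y))
      + Complex.I * L (ω (x - Complex.I • y) (x - Complex.I • y))) / 4 := fun x y => by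
    simp only [map_add, map_sub, LinearMap.add_apply, LinearMap.sub_apply, map_smul,
      LinearMap.map_smulₛₗ, LinearMap.smul_apply, smul_eq_mul, Complex.conj_I]
    ring_nf
    simp only [Complex.I_sq]
    ring
  have hunit : ∀ x y : E, ‖x‖ ≤ 1 → ‖y‖ ≤ 1 → ‖L (ω x y)‖ ≤ 4 * C := fun x y hx hy => by
    have hb : ∀ z : E, ‖z‖ ≤ 2 → ‖L (ω z z)‖ ≤ 4 * C := fun z hz => by
      refine (hqb z).trans ?_
      have : ‖z‖ ^ 2 ≤ 4 := by nlinarith [norm_nonneg z]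
      nlinarith
    have hIy : ‖Complex.I • y‖ ≤ 1 := by rw [norm_smul]; simpa using hy
    have h1 := hb (x + y) ((norm_add_le _ _).trans (by linarith))
    have h2 := hb (x - y) ((norm_sub_le _ _).trans (by linarith))
    have h3 := hb (x + Complex.I • y) ((norm_add_le _ _).trans (by linarith))
    have h4 := hb (x - Complex.I • y) ((norm_sub_le _ _).trans (by linarith))
    rw [hpol, norm_div]
    have : ‖(4 : ℂ)‖ = 4 := by simp
    rw [this, div_le_iff₀ (by norm_num)]
    refine (norm_add_le _ _).trans ?_
    have h5 := norm_sub_le (L (ω (x + y) (x + y)) - L (ω (x - y) (x - y)))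
      (Complex.I * L (ω (x + Complex.I • y) (x + Complex.I • y)))
    have h6 := norm_sub_le (L (ω (x + y) (x + y))) (L (ω (x - y) (x - y)))
    simp only [norm_mul, Complex.norm_I, one_mul] at *
    linarith
  have hbd : ∀ x y : E, ‖L (ω x y)‖ ≤ 4 * C * ‖x‖ * ‖y‖ := fun x y => by
    by_cases hx : x = 0
    · simp [hx]
    by_cases hy : y = 0
    · simp [hy]
    have hx' : ‖x‖ ≠ 0 := norm_ne_zero_iff.2 hx
    have hy' : ‖y‖ ≠ 0 := norm_ne_zero_iff.2 hy
    have h1 := hunit (((‖x‖ : ℂ)⁻¹) • x) (((‖y‖ : ℂ)⁻¹) • y)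
      (by rw [norm_smul]; simp [hx']) (by rw [norm_smul]; simp [hy'])
    simp only [map_smul, LinearMap.map_smulₛₗ, LinearMap.smul_apply, smul_eq_mul, norm_mul] at h1
    simp at h1
    have h2 : 0 < ‖x‖ := by positivity
    have h3 : 0 < ‖y‖ := by positivity
    field_simp at h1
    linarith
  let S : E →ₗ⋆[ℂ] E →ₗ[ℂ] ℂ :=
    LinearMap.mk₂'ₛₗ (starRingEnd ℂ) (RingHom.id ℂ) (fun x y => L (ω x y))
      (fun x y z => by simp) (fun a x y => by simp [LinearMap.map_smulₛₗ])
      (fun x y z => by simp) (fun a x y => by simp)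
  let B : E →L⋆[ℂ] E →L[ℂ] ℂ := S.mkContinuous₂ (4 * C) hbd
  refine ⟨ContinuousLinearMap.adjoint (InnerProductSpace.continuousLinearMapOfBilin B),
    fun ψ => ?_⟩
  rw [ContinuousLinearMap.adjoint_inner_right,
    InnerProductSpace.continuousLinearMapOfBilin_apply, ← hq]
  rfl

open Classical in
/-- `f(H)` for a bounded Borel function `f`: the bounded operator determined by
`⟨ψ, f(H) ψ⟩ = ∫ f dμ_ψ` for all `ψ`, with `μ_ψ` the spectral measure of `H` at `ψ`. -/
def borelFC (H : E →L[ℂ] E) (f : ℝ → ℂ) : E →L[ℂ] E :=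
  if h : ∃ A : E →L[ℂ] E, ∀ ψ : E, ⟪ψ, A ψ⟫_ℂ = ∫ t, f t ∂(spectralMeasure H ψ) then h.choose
  else 0

lemma inner_borelFC (H : E →L[ℂ] E) (f : ℝ → ℂ) (hf : Measurable f) (C : ℝ)
    (hfC : ∀ t, ‖f t‖ ≤ C) (ψ : E) :
    ⟪ψ, borelFC H f ψ⟫_ℂ = ∫ t, f t ∂(spectralMeasure H ψ) := by
  have h := exists_borelFC H f hf C hfC
  rw [borelFC, dif_pos h]
  exact h.choose_spec ψ

/-- The spectral projection `χ_S(H)`. -/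
def spectralProjection (H : E →L[ℂ] E) (S : Set ℝ) : E →L[ℂ] E :=
  borelFC H (S.indicator 1)

end BorelFunctionalCalculus

/-! ### Fredholm index

`ContinuousLinearMap.IsFredholm` is Mathlib's notion. -/

section Index

variable {E : Type*} [NormedAddCommGroup E] [InnerProductSpace ℂ E] [CompleteSpace E]

/-- The `ℤ`-valued index `dim ker F - dim ker F*` (meaningful for Fredholm `F`). -/
def fredholmIndex (F : E →L[ℂ] E) : ℤ :=
  (Module.finrank ℂ F.ker : ℤ) - (Module.finrank ℂ (ContinuousLinearMap.adjoint F).ker : ℤ)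

/-- The `ℤ/2`-valued index `dim ker F mod 2` (meaningful for `Θ`-odd Fredholm `F`). -/
def fredholmIndexTwo (F : E →L[ℂ] E) : ZMod 2 :=
  (Module.finrank ℂ F.ker : ZMod 2)

/-- `F` is `Θ`-odd: `F = -Θ F* Θ`. -/
def IsThetaOdd (Θ : E →ₗ⋆[ℂ] E) (F : E →L[ℂ] E) : Prop :=
  ∀ ψ : E, F ψ = -Θ (ContinuousLinearMap.adjoint F (Θ ψ))

/-- For a projection `Q`, the operator `ℚA = Q A Q + Q^⊥`. -/
def projCompression (Q A : E →L[ℂ] E) : E →L[ℂ] E :=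
  Q * A * Q + (1 - Q)

end Index

/-! ### Tight-binding operators on `ℓ²(ℤ²) ⊗ ℂ^N` -/

/-- The Hilbert space `ℓ²(ℤ²) ⊗ ℂ^N`, as square-summable functions `ℤ² → ℂ^N`. -/
abbrev BulkSpace (N : ℕ) : Type :=
  lp (fun _ : ℤ × ℤ => EuclideanSpace ℂ (Fin N)) 2

/-- The matrix element `A_{xy} = ⟨δ_x, A δ_y⟩`, as an operator on `ℂ^N`. -/
def matrixElement {N : ℕ} (A : BulkSpace N →L[ℂ] BulkSpace N) (x y : ℤ × ℤ) :
    EuclideanSpace ℂ (Fin N) →L[ℂ] EuclideanSpace ℂ (Fin N) :=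
  (lp.evalCLM ℂ (fun _ : ℤ × ℤ => EuclideanSpace ℂ (Fin N)) 2 x) ∘L A ∘L
    (lp.singleContinuousLinearMap ℂ (fun _ : ℤ × ℤ => EuclideanSpace ℂ (Fin N)) 2 y)

/-- Local operators: off-diagonal decay faster than any power. -/
def IsLocalOp {N : ℕ} (A : BulkSpace N →L[ℂ] BulkSpace N) : Prop :=
  ∀ᶠ α : ℕ in atTop, ∃ C : ℝ, ∀ x y : ℤ × ℤ,
    ‖matrixElement A x y‖ ≤ C * (1 + ‖x - y‖) ^ (-(α : ℤ))

/-- All members of the family `𝒜` are weakly local, with the same `ν` and the same constants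
`C_μ`. -/
def IsUniformlyWeaklyLocal {N : ℕ} (𝒜 : Set (BulkSpace N →L[ℂ] BulkSpace N)) : Prop :=
  ∃ ν : ℕ, ∀ᶠ μ : ℕ in atTop, ∃ C : ℝ, ∀ A ∈ 𝒜, ∀ x y : ℤ × ℤ,
    ‖matrixElement A x y‖ ≤ C * (1 + ‖x - y‖) ^ (-(μ : ℤ)) * (1 + ‖x‖) ^ ν

/-- A Hamiltonian is a self-adjoint local operator. -/
structure IsHamiltonian {N : ℕ} (H : BulkSpace N →L[ℂ] BulkSpace N) : Prop where
  selfAdjoint : IsSelfAdjoint H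
  isLocal : IsLocalOp H

/-- The Borel functions bounded by `1` which are constant on `(-∞, inf Δ]` (the set of lower bounds
of `Δ`) and constant on `[sup Δ, ∞)` (the set of upper bounds of `Δ`). -/
def borelOne (Δ : Set ℝ) : Set (ℝ → ℂ) :=
  {f | Measurable f ∧ (∀ t, ‖f t‖ ≤ 1) ∧
    (∃ c, ∀ t ∈ lowerBounds Δ, f t = c) ∧ (∃ c, ∀ t ∈ upperBounds Δ, f t = c)}

/-- The interval `Δ` is a mobility gap for the Hamiltonian `H`. -/
structure IsMobilityGap {N : ℕ} (H : BulkSpace N →L[ℂ] BulkSpace N) (Δ : Set ℝ) : Prop where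
  isHamiltonian : IsHamiltonian H
  isInterval : Δ.OrdConnected
  weaklyLocal : IsUniformlyWeaklyLocal (borelFC H '' borelOne Δ)
  finite_multiplicity : ∀ t ∈ Δ,
    FiniteDimensional ℂ (Module.End.eigenspace (H : Module.End ℂ (BulkSpace N)) (t : ℂ))

/-- The flux insertion operator `U = exp(i arg(X₁ + i X₂))`. -/
def fluxInsertion (N : ℕ) : BulkSpace N →L[ℂ] BulkSpace N :=
  lp.mapCLM 2 (K := 1)
    (fun x : ℤ × ℤ => Complex.exp (Complex.I * Complex.arg ((x.1 : ℂ) + Complex.I * (x.2 : ℂ))) •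
      ContinuousLinearMap.id ℂ (EuclideanSpace ℂ (Fin N)))
    zero_le_one
    (fun x => by
      rw [norm_smul, mul_comm Complex.I, Complex.norm_exp_ofReal_mul_I, one_mul]
      exact ContinuousLinearMap.norm_id_le)

/-- `Θ` is a Fermionic time-reversal symmetry: conjugate-linear, anti-unitary, `Θ² = -1`, and
commuting with the position operators `X₁`, `X₂`. In the last two fields `φ = X_j ψ` is expressed
by `φ(x) = x_j ψ(x)` for all `x`, for `ψ`, `φ` in the Hilbert space. -/
structure IsTimeReversal {N : ℕ} (Θ : BulkSpace N →ₗ⋆[ℂ] BulkSpace N) : Prop where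
  antiunitary : ∀ ψ φ : BulkSpace N, ⟪Θ ψ, Θ φ⟫_ℂ = ⟪φ, ψ⟫_ℂ
  sq_eq_neg_one : ∀ ψ : BulkSpace N, Θ (Θ ψ) = -ψ
  comm_position_one : ∀ ψ φ : BulkSpace N, (∀ x : ℤ × ℤ, φ x = (x.1 : ℂ) • ψ x) →
    ∀ x : ℤ × ℤ, (Θ φ) x = (x.1 : ℂ) • (Θ ψ) x
  comm_position_two : ∀ ψ φ : BulkSpace N, (∀ x : ℤ × ℤ, φ x = (x.2 : ℂ) • ψ x) →
    ∀ x : ℤ × ℤ, (Θ φ) x = (x.2 : ℂ) • (Θ ψ) x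

/-- `H` is time-reversal invariant: `[H, Θ] = 0`. -/
def IsTimeReversalInvariant {N : ℕ} (Θ : BulkSpace N →ₗ⋆[ℂ] BulkSpace N)
    (H : BulkSpace N →L[ℂ] BulkSpace N) : Prop :=
  ∀ ψ : BulkSpace N, H (Θ ψ) = Θ (H ψ)

end

/-! The spectrum in a mobility gap is essentially a set of finitely degenerate eigenvalues, and all
but finitely many of them can be neglected. One finds a finite `Λ ⊆ S` such that `P = χ_{S∖Λ}(H)`
satisfies `‖[P, U]‖ < 1` (`IsMobilityGap.exists_finite_norm_commutator_lt_one`). The removed part `R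
= χ_Λ(H)` has finite rank by finite multiplicity, and `Q = P + R`.

Algebra then finishes. The compression of `U` to `P` is invertible by a Neumann series. Hence so is
`T = (1 - R) ℚU + R`, which is that compression times a unipotent factor (`isUnit_schur`). Thus `ℚU`
is `T` plus an operator with values in the range of `R`: Fredholm of index zero.

For the `ℤ/2` index, the form `⟨Θψ, ℚU φ⟩` is alternating. Restricted to `W = ker ((1 - R) ℚU)`,
which `R` identifies with its own range, its radical is exactly `ker ℚU`. Alternating forms have
even rank, so `dim ker ℚU ≡ dim W = rank R` modulo 2, and `rank R` is even by Kramers degeneracy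
(`fredholmIndexTwo_eq_zero_of_schur`).

The commutator is estimated by a Schur test, with two regimes of rows. Far from the origin the phase
of `U` varies slowly, and interpolating the weakly local bound with `‖P_{xy}‖ ≤ 1` makes the row
sums small uniformly in `Λ`. This leaves the finitely many rows in a ball. There, `Λ` is chosen to
contain all heavy atoms of the spectral measures of the site vectors. What remains is light because
uniform weak locality over all step functions with unimodular or smaller coefficients bounds sums of
absolute values over spectral pieces (`IsMobilityGap.exists_measure_le_of_small_atoms`). -/

/-! ### Parity of the rank of an alternating form. -/

section AlternatingForms

variable {K V : Type*} [Field K] [CharZero K] [AddCommGroup V] [Module K V] [FiniteDimensional K V]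

/-- The Gram matrix is antisymmetric, so in odd dimension its determinant equals its own negative.
-/
lemma even_finrank_of_isAlt_of_nondegenerate (B : LinearMap.BilinForm K V) (hB : B.IsAlt)
    (hn : B.Nondegenerate) : Even (Module.finrank K V) := by
  let b := Module.finBasis K V
  have hd : (LinearMap.BilinForm.toMatrix b B).det ≠ 0 :=
    (LinearMap.BilinForm.nondegenerate_iff_det_ne_zero b).1 hn
  have ht : (LinearMap.BilinForm.toMatrix b B).transpose = -(LinearMap.BilinForm.toMatrix b B) := by
    ext i j
    simp only [Matrix.transpose_apply, LinearMap.BilinForm.toMatrix_apply, Matrix.neg_apply]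
    exact (hB.neg_eq _ _).symm
  have h := congrArg Matrix.det ht
  rw [Matrix.det_transpose, Matrix.det_neg, Fintype.card_fin] at h
  by_contra ho
  rw [Nat.not_even_iff_odd] at ho
  rw [ho.neg_one_pow] at h
  apply hd
  have : (2 : K) * (LinearMap.BilinForm.toMatrix b B).det = 0 := by linear_combination h
  simpa using this

/-- On a complement of the radical the form is nondegenerate, hence that complement has even
dimension. -/
lemma finrank_ker_eq_finrank_of_isAlt (B : LinearMap.BilinForm K V) (hB : B.IsAlt) :
    (Module.finrank K (LinearMap.ker B) : ZMod 2) = Module.finrank K V := by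
  obtain ⟨W, hW⟩ := Submodule.exists_isCompl (LinearMap.ker B)
  have hr : (B.restrict W).IsAlt := fun x => hB x
  have hn : (B.restrict W).Nondegenerate := by
    refine (LinearMap.IsRefl.nondegenerate_iff_separatingLeft (B := B.restrict W) hr.isRefl).2 ?_
    rintro ⟨x, hx⟩ h
    have hx0 : x ∈ LinearMap.ker B := by
      rw [LinearMap.mem_ker]
      ext y
      obtain ⟨u, hu, v, hv, rfl⟩ := Submodule.mem_sup.1
        (show y ∈ LinearMap.ker B ⊔ W by rw [hW.sup_eq_top]; trivial)
      have h1 : B x v = 0 := h ⟨v, hv⟩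
      have h2 : B x u = 0 := by
        rw [← hB.neg_eq, LinearMap.mem_ker.1 hu]; simp
      simp [h1, h2]
    have := Submodule.disjoint_def.1 hW.disjoint x hx0 hx
    simpa using this
  have he := even_finrank_of_isAlt_of_nondegenerate _ hr hn
  rw [← Submodule.finrank_add_eq_of_isCompl hW, Nat.cast_add,
    (ZMod.natCast_eq_zero_iff_even).2 he, add_zero]

end AlternatingForms

/-! ### Finite-rank perturbations of invertible operators have index zero. -/

section Fredholm

variable {E : Type*} [NormedAddCommGroup E] [InnerProductSpace ℂ E] [CompleteSpace E]

/-- `ker (1 + A B)` and `ker (1 + B A)` are isomorphic. -/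
def kerOneAddCompEquiv {R M M' : Type*} [Ring R] [AddCommGroup M] [Module R M] [AddCommGroup M']
    [Module R M'] (A : M' →ₗ[R] M) (B : M →ₗ[R] M') :
    LinearMap.ker (LinearMap.id + A ∘ₗ B) ≃ₗ[R] LinearMap.ker (LinearMap.id + B ∘ₗ A) where
  toFun x := ⟨B x, by
    have := x.2
    rw [LinearMap.mem_ker] at this ⊢
    have h := congrArg B this
    simp only [LinearMap.add_apply, LinearMap.id_apply, LinearMap.comp_apply, map_add,
      map_zero] at h ⊢
    exact h⟩
  map_add' x y := by ext; simp
  map_smul' c x := by ext; simp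
  invFun y := ⟨-A y, by
    have := y.2
    rw [LinearMap.mem_ker] at this ⊢
    have h := congrArg A this
    simp only [LinearMap.add_apply, LinearMap.id_apply, LinearMap.comp_apply, map_add, map_neg,
      map_zero] at h ⊢
    rw [add_comm, ← neg_eq_zero] at h
    rw [← h]; abel⟩
  left_inv x := by
    have := x.2
    rw [LinearMap.mem_ker] at this
    ext
    simp only [LinearMap.add_apply, LinearMap.id_apply, LinearMap.comp_apply] at this ⊢
    exact (eq_neg_of_add_eq_zero_left this).symm
  right_inv y := by
    have := y.2
    rw [LinearMap.mem_ker] at this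
    ext
    simp only [LinearMap.add_apply, LinearMap.id_apply, LinearMap.comp_apply, map_neg] at this ⊢
    exact (eq_neg_of_add_eq_zero_left this).symm

lemma finrank_ker_adjoint_of_finiteDimensional {V : Type*} [NormedAddCommGroup V]
    [InnerProductSpace ℂ V] [FiniteDimensional ℂ V] [CompleteSpace V] (M : V →L[ℂ] V) :
    Module.finrank ℂ (ContinuousLinearMap.adjoint M).ker = Module.finrank ℂ M.ker := by
  have h1 := M.orthogonal_range
  have h2 := Submodule.finrank_add_finrank_orthogonal M.range
  have h3 := LinearMap.finrank_range_add_finrank_ker (M : V →ₗ[ℂ] V)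
  rw [h1] at h2
  omega

omit [CompleteSpace E] in
lemma finrank_ker_mul_of_isUnit (A T : E →L[ℂ] E) (hT : IsUnit T) :
    Module.finrank ℂ (A * T).ker = Module.finrank ℂ A.ker := by
  obtain ⟨t, rfl⟩ := hT
  let e : E ≃L[ℂ] E := ContinuousLinearEquiv.unitsEquiv ℂ E t
  have : (A * t : E →L[ℂ] E).ker = Submodule.comap e.toLinearEquiv.toLinearMap A.ker := by
    ext x; rfl
  rw [this]
  exact (e.toLinearEquiv.ofSubmodule' A.ker).finrank_eq

omit [CompleteSpace E] in
lemma finrank_ker_mul_of_isUnit_left (T A : E →L[ℂ] E) (hT : IsUnit T) :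
    Module.finrank ℂ (T * A).ker = Module.finrank ℂ A.ker := by
  obtain ⟨t, rfl⟩ := hT
  let e : E ≃L[ℂ] E := ContinuousLinearEquiv.unitsEquiv ℂ E t
  have : (t * A : E →L[ℂ] E).ker = A.ker := by
    ext x
    exact e.map_eq_zero_iff
  rw [this]

variable {V : Type*} [NormedAddCommGroup V] [InnerProductSpace ℂ V] [FiniteDimensional ℂ V]
  [CompleteSpace V]

omit [CompleteSpace E] [CompleteSpace V] in
-- The inverse of `T` inverts the perturbed operator modulo finite rank.
lemma isFredholm_isUnit_add_finiteRank (T : E →L[ℂ] E) (hT : IsUnit T) (A : V →L[ℂ] E)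
    (B : E →L[ℂ] V) : (T + A ∘L B).IsFredholm := by
  obtain ⟨t, rfl⟩ := hT
  refine ContinuousLinearMap.IsFredholm.of_isQuasiInverse
    (v := ((t⁻¹ : (E →L[ℂ] E)ˣ) : E →L[ℂ] E)) ⟨?_, ?_⟩
  · refine LinearMap.FiniteRangeSetoid.equiv_iff_hasFiniteRange.2 ?_
    have : (((t⁻¹ : (E →L[ℂ] E)ˣ) : E →L[ℂ] E) : E →ₗ[ℂ] E) ∘ₗ
        (((t : E →L[ℂ] E) + A ∘L B : E →L[ℂ] E) : E →ₗ[ℂ] E) - LinearMap.id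
        = ((((t⁻¹ : (E →L[ℂ] E)ˣ) : E →L[ℂ] E) : E →ₗ[ℂ] E) ∘ₗ (A : V →ₗ[ℂ] E)) ∘ₗ
          (B : E →ₗ[ℂ] V) := by
      ext x
      have : ((t⁻¹ : (E →L[ℂ] E)ˣ) : E →L[ℂ] E) ((t : E →L[ℂ] E) x) = x := by
        rw [← mul_apply_eq_comp]; simp
      simp [this]
    rw [this]
    exact LinearMap.HasFiniteRange.comp_right (v := (((t⁻¹ : (E →L[ℂ] E)ˣ) : E →L[ℂ] E) :
      E →ₗ[ℂ] E) ∘ₗ (A : V →ₗ[ℂ] E)) LinearMap.HasFiniteRange.of_finite_dom _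
  · refine LinearMap.FiniteRangeSetoid.equiv_iff_hasFiniteRange.2 ?_
    have : (((t : E →L[ℂ] E) + A ∘L B : E →L[ℂ] E) : E →ₗ[ℂ] E) ∘ₗ
        (((t⁻¹ : (E →L[ℂ] E)ˣ) : E →L[ℂ] E) : E →ₗ[ℂ] E) - LinearMap.id
        = (A : V →ₗ[ℂ] E) ∘ₗ ((B : E →ₗ[ℂ] V) ∘ₗ
          (((t⁻¹ : (E →L[ℂ] E)ˣ) : E →L[ℂ] E) : E →ₗ[ℂ] E)) := by
      ext x
      have : (t : E →L[ℂ] E) (((t⁻¹ : (E →L[ℂ] E)ˣ) : E →L[ℂ] E) x) = x := by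
        rw [← mul_apply_eq_comp]; simp
      simp [this]
    rw [this]
    exact LinearMap.HasFiniteRange.comp_right (LinearMap.HasFiniteRange.of_finite_dom) _

/-- Dividing by `T` leaves `1 + A B'`. Its kernel and that of its adjoint are transported by
`kerOneAddCompEquiv` to those of `1 + B' A` on the finite-dimensional `V`, where an operator and its
adjoint have equal nullity. -/
lemma fredholmIndex_isUnit_add_finiteRank (T : E →L[ℂ] E) (hT : IsUnit T) (A : V →L[ℂ] E)
    (B : E →L[ℂ] V) : fredholmIndex (T + A ∘L B) = 0 := by
  obtain ⟨t, rfl⟩ := hT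
  set B' : E →L[ℂ] V := B ∘L ((t⁻¹ : (E →L[ℂ] E)ˣ) : E →L[ℂ] E) with hB'
  have hF : (t : E →L[ℂ] E) + A ∘L B = (1 + A ∘L B') * t := by
    ext x
    have : ((t⁻¹ : (E →L[ℂ] E)ˣ) : E →L[ℂ] E) ((t : E →L[ℂ] E) x) = x := by
      rw [← mul_apply_eq_comp]; simp
    simp [hB', this]
  have h1 : Module.finrank ℂ ((t : E →L[ℂ] E) + A ∘L B).ker
      = Module.finrank ℂ (1 + B' ∘L A : V →L[ℂ] V).ker := by
    rw [hF, finrank_ker_mul_of_isUnit _ _ t.isUnit]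
    exact (kerOneAddCompEquiv (A : V →ₗ[ℂ] E) (B' : E →ₗ[ℂ] V)).finrank_eq
  have h2 : Module.finrank ℂ (ContinuousLinearMap.adjoint ((t : E →L[ℂ] E) + A ∘L B)).ker
      = Module.finrank ℂ (ContinuousLinearMap.adjoint (1 + B' ∘L A : V →L[ℂ] V)).ker := by
    rw [hF, ← ContinuousLinearMap.star_eq_adjoint, star_mul,
      finrank_ker_mul_of_isUnit_left _ _ t.isUnit.star, ContinuousLinearMap.star_eq_adjoint,
      map_add, map_add, ContinuousLinearMap.adjoint_comp A B', ContinuousLinearMap.adjoint_comp B' A,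
      ← ContinuousLinearMap.star_eq_adjoint 1, ← ContinuousLinearMap.star_eq_adjoint 1, star_one,
      star_one]
    exact (kerOneAddCompEquiv (ContinuousLinearMap.adjoint B' : V →ₗ[ℂ] E)
      (ContinuousLinearMap.adjoint A : E →ₗ[ℂ] V)).finrank_eq
  rw [fredholmIndex, h1, h2, finrank_ker_adjoint_of_finiteDimensional, sub_self]

end Fredholm

/-! ### Compressions of unitaries, their Schur complements, and `Θ`-odd operators. -/

section ThetaOdd

variable {E : Type*} [NormedAddCommGroup E] [InnerProductSpace ℂ E] [CompleteSpace E]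

lemma isUnit_of_isUnit_mul_of_isUnit_mul {M : Type*} [Monoid M] {a b c : M} (h1 : IsUnit (b * a))
    (h2 : IsUnit (a * c)) : IsUnit a := by
  obtain ⟨u, hu⟩ := h1
  obtain ⟨v, hv⟩ := h2
  have hl : (↑u⁻¹ * b) * a = 1 := by rw [mul_assoc, ← hu, Units.inv_mul]
  have hr : a * (c * ↑v⁻¹) = 1 := by rw [← mul_assoc, ← hv, Units.mul_inv]
  have : (↑u⁻¹ * b) = c * ↑v⁻¹ := left_inv_eq_right_inv hl hr
  exact ⟨⟨a, c * ↑v⁻¹, hr, this ▸ hl⟩, rfl⟩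

/-- The compression of a unitary to a projection almost commuting with it is invertible. -/
lemma isUnit_projCompression {P U : E →L[ℂ] E} (hP : IsStarProjection P)
    (hU : U ∈ unitary (E →L[ℂ] E)) (hPU : ‖P * U - U * P‖ < 1) : IsUnit (projCompression P U) := by
  have key : ∀ V : E →L[ℂ] E, V ∈ unitary (E →L[ℂ] E) → ‖P * V - V * P‖ < 1 →
      IsUnit (projCompression P (star V) * projCompression P V) := by
    intro V hV hPV
    have hPP : P * P = P := hP.isIdempotentElem
    have hVV : star V * V = 1 := (Unitary.mem_iff.1 hV).1
    -- The defect is the off-diagonal term `P V* (1 - P) V P`, and `(1 - P) V P = (1 - P) [V, P] P`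
    -- is controlled by the commutator, so a Neumann series applies.
    have h : projCompression P (star V) * projCompression P V
        = 1 - P * star V * (1 - P) * ((V * P - P * V) * P) := by
      have e1 : (1 - P) * ((V * P - P * V) * P) = V * P - P * V * P := by
        simp only [sub_mul, mul_sub, one_mul, mul_assoc, hPP]
        simp only [← mul_assoc, hPP]; abel
      rw [mul_assoc (P * star V), e1]
      simp only [projCompression, mul_sub, sub_mul, mul_add, add_mul, mul_one, one_mul]
      have e2 : P * star V * (V * P) = P := by
        rw [mul_assoc, ← mul_assoc (star V), hVV, one_mul, hPP]
      rw [e2]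
      simp only [mul_assoc, hPP]
      simp only [← mul_assoc, hPP]
      abel
    rw [h]
    refine (Units.oneSub _ ?_).isUnit
    have hP1 : ‖P‖ ≤ 1 := hP.norm_le
    have hP2 : ‖1 - P‖ ≤ 1 := hP.one_sub.norm_le
    have hV1 : ‖star V‖ ≤ 1 := by
      rw [norm_star]
      have h2 : ‖V‖ * ‖V‖ = ‖(1 : E →L[ℂ] E)‖ := by rw [← CStarRing.norm_star_mul_self, hVV]
      have h3 : ‖(1 : E →L[ℂ] E)‖ ≤ 1 := ContinuousLinearMap.norm_id_le
      nlinarith [norm_nonneg V]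
    have a1 : ‖P * star V * (1 - P)‖ ≤ 1 := by
      refine (norm_mul_le _ _).trans (mul_le_one₀ ((norm_mul_le _ _).trans
        (mul_le_one₀ hP1 (norm_nonneg _) hV1)) (norm_nonneg _) hP2)
    have a2 : ‖(V * P - P * V) * P‖ < 1 := by
      refine (norm_mul_le _ _).trans_lt ?_
      rw [norm_sub_rev]
      nlinarith [norm_nonneg (P * V - V * P), norm_nonneg P]
    refine (norm_mul_le _ _).trans_lt ?_
    nlinarith [norm_nonneg (P * star V * (1 - P)), norm_nonneg ((V * P - P * V) * P)]
  -- The same compression of `U*` serves on both sides: `key` for `U` gives the left product, `key`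
  -- for `U*` the right one.
  refine isUnit_of_isUnit_mul_of_isUnit_mul (b := projCompression P (star U))
    (c := projCompression P (star U)) (key U hU hPU) ?_
  have h := key (star U) (Unitary.star_mem hU) ?_
  · rwa [star_star] at h
  · have : P * star U - star U * P = - star (P * U - U * P) := by
      simp [hP.isSelfAdjoint.star_eq]
    rw [this, norm_neg, norm_star]; exact hPU

/-- `1 - R` times the compression to `P + R`, plus `R`, for `R` orthogonal to `P`, is invertible. -/
lemma isUnit_schur {P R U : E →L[ℂ] E} (hP : IsStarProjection P) (hR : IsStarProjection R)
    (hPR : P * R = 0) (hU : U ∈ unitary (E →L[ℂ] E)) (hPU : ‖P * U - U * P‖ < 1) :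
    IsUnit ((1 - R) * projCompression (P + R) U + R) := by
  have hRP : R * P = 0 := by
    have := congrArg star hPR
    rwa [star_mul, hP.isSelfAdjoint.star_eq, hR.isSelfAdjoint.star_eq, star_zero] at this
  have hPP : P * P = P := hP.isIdempotentElem
  have hRR : R * R = R := hR.isIdempotentElem
  -- The first factor is unipotent: `R P = 0` makes `P U R` square to zero.
  have hf : (1 - R) * projCompression (P + R) U + R
      = (1 + P * U * R) * projCompression P U := by
    have e1 : (1 - R) * (P + R) = P := by
      simp only [sub_mul, one_mul, mul_add, hRP, hRR]; abel
    have e2 : R * projCompression P U = R := by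
      simp only [projCompression, mul_add, mul_sub, ← mul_assoc, hRP, zero_mul, mul_one]; abel
    rw [add_mul, one_mul, mul_assoc _ R, e2]
    simp only [projCompression, mul_add, ← mul_assoc, e1]
    have e3 : (1 - R) * (1 - (P + R)) = 1 - P - R := by
      rw [mul_sub, e1]; simp only [mul_one]; abel
    rw [e3]; abel
  rw [hf]
  refine IsUnit.mul ⟨⟨1 + P * U * R, 1 - P * U * R, ?_, ?_⟩, rfl⟩ (isUnit_projCompression hP hU hPU)
  all_goals
    have : P * U * R * (P * U * R) = 0 := by
      rw [mul_assoc (P * U), ← mul_assoc R, ← mul_assoc R, hRP]; simp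
    simp only [mul_add, add_mul, mul_sub, sub_mul, one_mul, mul_one, this]; abel

omit [CompleteSpace E] in
-- The two operators differ by `R F - R`, which takes values in the range of `R`.
lemma projCompression_eq_add_comp (P R U : E →L[ℂ] E) :
    ∃ B : E →L[ℂ] R.range, projCompression (P + R) U
      = ((1 - R) * projCompression (P + R) U + R) + R.range.subtypeL ∘L B := by
  have h : ∀ x, (R * projCompression (P + R) U - R) x ∈ R.range := fun x =>
    ⟨(projCompression (P + R) U x - x), by simp⟩
  refine ⟨(R * projCompression (P + R) U - R).codRestrict R.range h, ?_⟩
  · ext x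
    have : (R.range.subtypeL ∘L (R * projCompression (P + R) U - R).codRestrict R.range h) x
      = R (projCompression (P + R) U x) - R x := rfl
    rw [add_apply, this]
    simp

lemma isFredholm_projCompression {P R U : E →L[ℂ] E} (hP : IsStarProjection P)
    (hR : IsStarProjection R) (hPR : P * R = 0) (hU : U ∈ unitary (E →L[ℂ] E))
    (hPU : ‖P * U - U * P‖ < 1) [FiniteDimensional ℂ R.range] :
    (projCompression (P + R) U).IsFredholm ∧ fredholmIndex (projCompression (P + R) U) = 0 := by
  obtain ⟨B, hB⟩ := projCompression_eq_add_comp P R U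
  have hT := isUnit_schur hP hR hPR hU hPU
  have : CompleteSpace R.range := FiniteDimensional.complete ℂ _
  rw [hB]
  exact ⟨isFredholm_isUnit_add_finiteRank _ hT _ _, fredholmIndex_isUnit_add_finiteRank _ hT _ _⟩

/-- A conjugate-linear antiunitary map squaring to `-1`. -/
structure IsQuaternionic (Θ : E →ₗ⋆[ℂ] E) : Prop where
  antiunitary : ∀ ψ φ : E, ⟪Θ ψ, Θ φ⟫_ℂ = ⟪φ, ψ⟫_ℂ
  sq_eq_neg_one : ∀ ψ : E, Θ (Θ ψ) = -ψ

/-- The bilinear form `⟨Θ ψ, F φ⟩`. -/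
noncomputable def thetaForm (Θ : E →ₗ⋆[ℂ] E) (F : E →L[ℂ] E) : LinearMap.BilinForm ℂ E :=
  LinearMap.mk₂ ℂ (fun ψ φ => ⟪Θ ψ, F φ⟫_ℂ) (by simp)
    (by simp [LinearMap.map_smulₛₗ, mul_comm]) (by simp) (by simp)

omit [CompleteSpace E] in
lemma thetaForm_apply (Θ : E →ₗ⋆[ℂ] E) (F : E →L[ℂ] E) (ψ φ : E) :
    thetaForm Θ F ψ φ = ⟪Θ ψ, F φ⟫_ℂ := rfl

/-- Oddness replaces `F` by `-Θ F* Θ`, and antiunitarity then turns `⟨Θφ, Fφ⟩` into its own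
negative. -/
lemma isAlt_thetaForm {Θ : E →ₗ⋆[ℂ] E} (hΘ : IsQuaternionic Θ) {F : E →L[ℂ] E}
    (hF : IsThetaOdd Θ F) : (thetaForm Θ F).IsAlt := by
  intro φ
  have h : ⟪Θ φ, F φ⟫_ℂ = -⟪Θ φ, F φ⟫_ℂ := by
    conv_lhs => rw [hF φ, inner_neg_right, hΘ.antiunitary,
      ContinuousLinearMap.adjoint_inner_left]
  rw [thetaForm_apply]
  have h2 : (2 : ℂ) * ⟪Θ φ, F φ⟫_ℂ = 0 := by linear_combination h
  simpa using h2

omit [CompleteSpace E] in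
lemma IsQuaternionic.eq_zero_of_forall {Θ : E →ₗ⋆[ℂ] E} (hΘ : IsQuaternionic Θ) {φ : E}
    (h : ∀ ψ, ⟪Θ ψ, φ⟫_ℂ = 0) : φ = 0 := by
  have := h (Θ φ)
  rw [hΘ.sq_eq_neg_one, inner_neg_left, neg_eq_zero] at this
  exact inner_self_eq_zero.1 this

/-- Kramers degeneracy: `⟨Θψ, φ⟩` is an alternating form on the range of `R`, nondegenerate because
`Θ` preserves this range. -/
lemma even_finrank_range_of_commute {Θ : E →ₗ⋆[ℂ] E} (hΘ : IsQuaternionic Θ) {R : E →L[ℂ] E}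
    (hR : IsStarProjection R) [FiniteDimensional ℂ R.range] (hΘR : ∀ ψ, R (Θ ψ) = Θ (R ψ)) :
    (Module.finrank ℂ R.range : ZMod 2) = 0 := by
  have hRR : ∀ x, R (R x) = R x := fun x => by
    rw [← mul_apply_eq_comp, hR.isIdempotentElem.eq]
  have hodd : IsThetaOdd Θ (1 : E →L[ℂ] E) := fun ψ => by
    rw [← ContinuousLinearMap.star_eq_adjoint, star_one]
    simp [hΘ.sq_eq_neg_one]
  let B := (thetaForm Θ 1).restrict R.range
  have hB : B.IsAlt := fun x => isAlt_thetaForm hΘ hodd x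
  have hk : LinearMap.ker B = ⊥ := by
    rw [LinearMap.ker_eq_bot']
    rintro ⟨x, y, rfl⟩ hx
    have h1 : ⟪Θ (R y), Θ (R y)⟫_ℂ = 0 := by
      have := congrArg (fun l => l ⟨R (Θ (R y)), _, rfl⟩) hx
      have h2 : ⟪Θ (R y), R (Θ (R y))⟫_ℂ = 0 := this
      rwa [hΘR, hRR] at h2
    rw [hΘ.antiunitary] at h1
    ext
    exact inner_self_eq_zero.1 h1
  have := finrank_ker_eq_finrank_of_isAlt B hB
  rw [hk, finrank_bot] at this
  rw [← this]; simp

/-- On `W = ker ((1 - R) F)` the invertible `T = (1 - R) F + R` agrees with `R`, whence `W ≃ range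
R`. The form `⟨Θψ, Fφ⟩` restricted to `W` has radical `ker F`, and evenness of its rank compares the
parities of `dim ker F` and `rank R`. -/
lemma fredholmIndexTwo_eq_zero_of_schur {Θ : E →ₗ⋆[ℂ] E} (hΘ : IsQuaternionic Θ)
    {F R : E →L[ℂ] E} (hF : IsThetaOdd Θ F) (hR : IsStarProjection R)
    [FiniteDimensional ℂ R.range] (hΘR : ∀ ψ, R (Θ ψ) = Θ (R ψ))
    (hT : IsUnit ((1 - R) * F + R)) : fredholmIndexTwo F = 0 := by
  obtain ⟨t, ht⟩ := hT
  set T' : E →L[ℂ] E := ((t⁻¹ : (E →L[ℂ] E)ˣ) : E →L[ℂ] E) with hT'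
  have hRR : ∀ x, R (R x) = R x := fun x => by
    rw [← mul_apply_eq_comp, hR.isIdempotentElem.eq]
  have hTapp : ∀ x, (t : E →L[ℂ] E) x = F x - R (F x) + R x := fun x => by
    rw [ht]; simp
  have h1 : ∀ x, T' ((t : E →L[ℂ] E) x) = x := fun x => by
    rw [← mul_apply_eq_comp]; simp [hT']
  have h2 : ∀ x, (t : E →L[ℂ] E) (T' x) = x := fun x => by
    rw [← mul_apply_eq_comp]; simp [hT']
  have hRT : ∀ x, R ((t : E →L[ℂ] E) x) = R x := fun x => by rw [hTapp]; simp [hRR]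
  let W : Submodule ℂ E := LinearMap.ker (((1 - R) * F : E →L[ℂ] E) : E →ₗ[ℂ] E)
  have hW : ∀ x, x ∈ W ↔ F x - R (F x) = 0 := fun x => by
    simp [W, LinearMap.mem_ker]
  have hT'W : ∀ x, T' (R x) ∈ W := fun x => by
    rw [hW]
    have := hTapp (T' (R x))
    rw [h2] at this
    have h3 := hRT (T' (R x))
    rw [h2, hRR] at h3
    rw [← h3] at this
    simpa using this
  have hWR : ∀ x ∈ W, T' (R x) = x := fun x hx => by
    rw [hW] at hx
    have := hTapp x
    rw [hx, zero_add] at this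
    rw [← this, h1]
  have hRT' : ∀ x, R (T' (R x)) = R x := fun x => by
    rw [← hRT (T' (R x)), h2, hRR]
  let e : W ≃ₗ[ℂ] R.range :=
    { toFun := fun x => ⟨R x, x, rfl⟩
      map_add' := fun x y => by ext; simp
      map_smul' := fun c x => by ext; simp
      invFun := fun y => ⟨T' y, by obtain ⟨_, x, rfl⟩ := y; exact hT'W x⟩
      left_inv := fun x => by ext; exact hWR x x.2
      right_inv := fun y => by obtain ⟨_, x, rfl⟩ := y; ext; exact hRT' x }
  have : FiniteDimensional ℂ W := e.symm.finiteDimensional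
  let B := (thetaForm Θ F).restrict W
  have hB : B.IsAlt := fun x => isAlt_thetaForm hΘ hF x
  have hkW : F.ker ≤ W := fun x hx => by
    rw [hW]
    have : F x = 0 := hx
    simp [this]
  have hker : LinearMap.ker B = F.ker.comap W.subtype := by
    ext ⟨x, hx⟩
    constructor
    · intro h
      show F x = 0
      refine hΘ.eq_zero_of_forall fun ψ => ?_
      -- Split `ψ` into `T' (R ψ) ∈ W` and a vector of `ker R`. The first part pairs to zero because
      -- `x` is in the radical; the second because `F x` lies in the range of `R`, which is
      -- orthogonal to `Θ (ker R)`.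
      have e1 : ⟪Θ (T' (R ψ)), F x⟫_ℂ = 0 := by
        have h0 : B ⟨x, hx⟩ ⟨T' (R ψ), hT'W ψ⟩ = 0 := by rw [LinearMap.mem_ker.1 h]; rfl
        rw [← hB.neg_eq, neg_eq_zero] at h0
        exact h0
      have e2 : R (ψ - T' (R ψ)) = 0 := by rw [map_sub, hRT', sub_self]
      have e3 : ⟪Θ (ψ - T' (R ψ)), F x⟫_ℂ = 0 := by
        have hx' : F x = R (F x) := sub_eq_zero.1 ((hW x).1 hx)
        rw [hx']
        have : ContinuousLinearMap.adjoint R = R := hR.isSelfAdjoint.star_eq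
        rw [← ContinuousLinearMap.adjoint_inner_left, this, hΘR, e2]
        simp
      rw [map_sub, inner_sub_left, e1, sub_zero] at e3
      exact e3
    · intro h
      have h' : F x = 0 := h
      ext ⟨y, hy⟩
      rw [← hB.neg_eq]
      show -⟪Θ y, F x⟫_ℂ = 0
      simp [h']
  have h3 := finrank_ker_eq_finrank_of_isAlt B hB
  rw [e.finrank_eq, even_finrank_range_of_commute hΘ hR hΘR, hker,
    (Submodule.comapSubtypeEquivOfLe hkW).finrank_eq] at h3
  exact h3

/-- Since `Θ` commutes with `Q` and intertwines `U` with `U*`, it intertwines the compression with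
its adjoint; `Θ² = -1` supplies the sign. -/
lemma isThetaOdd_projCompression {Θ : E →ₗ⋆[ℂ] E} (hΘ : IsQuaternionic Θ) {Q U : E →L[ℂ] E}
    (hQ : IsStarProjection Q) (hΘQ : ∀ ψ, Q (Θ ψ) = Θ (Q ψ))
    (hΘU : ∀ ψ, star U (Θ ψ) = Θ (U ψ)) : IsThetaOdd Θ (projCompression Q U) := by
  intro ψ
  have hstar : ContinuousLinearMap.adjoint (projCompression Q U) = projCompression Q (star U) := by
    rw [← ContinuousLinearMap.star_eq_adjoint]
    simp [projCompression, hQ.isSelfAdjoint.star_eq, mul_assoc]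
  rw [hstar]
  have : projCompression Q (star U) (Θ ψ) = Θ (projCompression Q U ψ) := by
    simp [projCompression, hΘQ, hΘU]
  rw [this, hΘ.sq_eq_neg_one, neg_neg]

end ThetaOdd

/-! ### Algebraic properties of the bounded Borel functional calculus. -/

section FunctionalCalculus

variable {E : Type*} [NormedAddCommGroup E] [InnerProductSpace ℂ E] [CompleteSpace E]
  {H : E →L[ℂ] E}

/-- Bounded measurable functions `ℝ → 𝕜`. -/
def IsBoundedBorel {𝕜 : Type*} [RCLike 𝕜] (f : ℝ → 𝕜) : Prop :=
  Measurable f ∧ ∃ C, ∀ t, ‖f t‖ ≤ C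

namespace IsBoundedBorel

variable {𝕜 : Type*} [RCLike 𝕜] {f g : ℝ → 𝕜}

lemma add (hf : IsBoundedBorel f) (hg : IsBoundedBorel g) :
    IsBoundedBorel (fun t => f t + g t) := by
  obtain ⟨hf, C, hC⟩ := hf
  obtain ⟨hg, D, hD⟩ := hg
  exact ⟨hf.add hg, C + D, fun t => (norm_add_le _ _).trans (add_le_add (hC t) (hD t))⟩

lemma mul (hf : IsBoundedBorel f) (hg : IsBoundedBorel g) :
    IsBoundedBorel (fun t => f t * g t) := by
  obtain ⟨hf, C, hC⟩ := hf
  obtain ⟨hg, D, hD⟩ := hg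
  refine ⟨hf.mul hg, C * D, fun t => (norm_mul_le _ _).trans ?_⟩
  exact mul_le_mul (hC t) (hD t) (norm_nonneg _) ((norm_nonneg _).trans (hC t))

lemma const (c : 𝕜) : IsBoundedBorel (fun _ : ℝ => c) := ⟨measurable_const, ‖c‖, fun _ => le_rfl⟩

lemma const_mul (hf : IsBoundedBorel f) (c : 𝕜) : IsBoundedBorel (fun t => c * f t) :=
  (const c).mul hf

lemma sub (hf : IsBoundedBorel f) (hg : IsBoundedBorel g) :
    IsBoundedBorel (fun t => f t - g t) := by
  simpa [sub_eq_add_neg] using hf.add (hg.const_mul (-1))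

lemma sum {ι : Type*} (s : Finset ι) {f : ι → ℝ → 𝕜} (hf : ∀ i ∈ s, IsBoundedBorel (f i)) :
    IsBoundedBorel (fun t => ∑ i ∈ s, f i t) := by
  classical
  induction s using Finset.induction_on with
  | empty => simpa using const (0 : 𝕜)
  | insert i s hi ih =>
    simp only [Finset.sum_insert hi]
    exact (hf i (by simp)).add (ih fun j hj => hf j (by simp [hj]))

lemma ofReal {f : ℝ → ℝ} (hf : IsBoundedBorel f) : IsBoundedBorel (fun t => (f t : ℂ)) := by
  obtain ⟨hf, C, hC⟩ := hf
  exact ⟨Complex.measurable_ofReal.comp hf, C, fun t => by simpa using hC t⟩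

lemma indicator_one {S : Set ℝ} (hS : MeasurableSet S) :
    IsBoundedBorel (S.indicator (1 : ℝ → 𝕜)) := by
  refine ⟨measurable_one.indicator hS, 1, fun t => ?_⟩
  by_cases h : t ∈ S <;> simp [h]

lemma of_compactlySupported (g : C_c(ℝ, ℝ)) : IsBoundedBorel (g : ℝ → ℝ) := by
  obtain ⟨C, hC⟩ := g.continuous.bounded_above_of_compact_support g.hasCompactSupport
  exact ⟨g.continuous.measurable, C, hC⟩

lemma integrable (hf : IsBoundedBorel f) (μ : Measure ℝ) [IsFiniteMeasure μ] : Integrable f μ := by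
  obtain ⟨hf, C, hC⟩ := hf
  exact Integrable.of_bound hf.aestronglyMeasurable C (ae_of_all _ hC)

end IsBoundedBorel

lemma IsBoundedBorel.inner_borelFC {f : ℝ → ℂ} (hf : IsBoundedBorel f) (ψ : E) :
    ⟪ψ, borelFC H f ψ⟫_ℂ = ∫ t, f t ∂(spectralMeasure H ψ) := by
  obtain ⟨hf, C, hC⟩ := hf
  exact _root_.inner_borelFC H f hf C hC ψ

omit [CompleteSpace E] in
lemma eq_of_forall_inner_self_eq {A B : E →L[ℂ] E} (h : ∀ ψ, ⟪ψ, A ψ⟫_ℂ = ⟪ψ, B ψ⟫_ℂ) : A = B := by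
  have : (A : E →ₗ[ℂ] E) = B := by
    refine (ext_inner_map _ _).1 fun x => ?_
    have := congrArg (starRingEnd ℂ) (h x)
    simp only [inner_conj_symm] at this
    exact this
  ext x
  exact LinearMap.congr_fun this x

lemma borelFC_eq_of_forall {f : ℝ → ℂ} (hf : IsBoundedBorel f) {A : E →L[ℂ] E}
    (h : ∀ ψ, ⟪ψ, A ψ⟫_ℂ = ∫ t, f t ∂(spectralMeasure H ψ)) : borelFC H f = A :=
  eq_of_forall_inner_self_eq fun ψ => by rw [hf.inner_borelFC, h]

lemma borelFC_add {f g : ℝ → ℂ} (hf : IsBoundedBorel f) (hg : IsBoundedBorel g) :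
    borelFC H (fun t => f t + g t) = borelFC H f + borelFC H g :=
  borelFC_eq_of_forall (hf.add hg) fun ψ => by
    rw [integral_add (hf.integrable _) (hg.integrable _), add_apply, inner_add_right,
      hf.inner_borelFC, hg.inner_borelFC]

lemma borelFC_const_mul {f : ℝ → ℂ} (hf : IsBoundedBorel f) (c : ℂ) :
    borelFC H (fun t => c * f t) = c • borelFC H f :=
  borelFC_eq_of_forall (hf.const_mul c) fun ψ => by
    rw [integral_const_mul, smul_apply, inner_smul_right, hf.inner_borelFC]

lemma borelFC_sub {f g : ℝ → ℂ} (hf : IsBoundedBorel f) (hg : IsBoundedBorel g) :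
    borelFC H (fun t => f t - g t) = borelFC H f - borelFC H g :=
  borelFC_eq_of_forall (hf.sub hg) fun ψ => by
    rw [integral_sub (hf.integrable _) (hg.integrable _), sub_apply, inner_sub_right,
      hf.inner_borelFC, hg.inner_borelFC]

lemma borelFC_sum {ι : Type*} (s : Finset ι) {f : ι → ℝ → ℂ}
    (hf : ∀ i ∈ s, IsBoundedBorel (f i)) :
    borelFC H (fun t => ∑ i ∈ s, f i t) = ∑ i ∈ s, borelFC H (f i) :=
  borelFC_eq_of_forall (IsBoundedBorel.sum s hf) fun ψ => by
    rw [integral_finsetSum _ fun i hi => (hf i hi).integrable _, sum_apply,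
      inner_sum]
    exact Finset.sum_congr rfl fun i hi => (hf i hi).inner_borelFC ψ

lemma isSelfAdjoint_borelFC {f : ℝ → ℝ} (hf : IsBoundedBorel f) :
    IsSelfAdjoint (borelFC H (fun t => (f t : ℂ))) := by
  refine eq_of_forall_inner_self_eq fun ψ => ?_
  rw [ContinuousLinearMap.star_eq_adjoint, ContinuousLinearMap.adjoint_inner_right,
    ← inner_conj_symm, hf.ofReal.inner_borelFC, integral_complex_ofReal, Complex.conj_ofReal]

lemma borelFC_compactlySupported (g : C_c(ℝ, ℝ)) :
    borelFC H (fun t => (g t : ℂ)) = cfc (g : ℝ → ℝ) H := by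
  refine borelFC_eq_of_forall (IsBoundedBorel.of_compactlySupported g).ofReal fun ψ => ?_
  rw [integral_complex_ofReal, integral_spectralMeasure]
  have h : IsSelfAdjoint (cfc (g : ℝ → ℝ) H) := cfc_predicate _ _
  have h1 : (starRingEnd ℂ) ⟪ψ, cfc (g : ℝ → ℝ) H ψ⟫_ℂ = ⟪ψ, cfc (g : ℝ → ℝ) H ψ⟫_ℂ := by
    rw [inner_conj_symm, ← ContinuousLinearMap.adjoint_inner_right,
      ← ContinuousLinearMap.star_eq_adjoint, h.star_eq]
  exact (Complex.conj_eq_iff_re.1 h1).symm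

/-- A finite measure dominating the complex spectral measure of `H` at `(a, b)`. -/
noncomputable def polarMeasure (H : E →L[ℂ] E) (a b : E) : Measure ℝ :=
  spectralMeasure H (b + a) + spectralMeasure H (b - a) +
    spectralMeasure H (b + Complex.I • a) + spectralMeasure H (b - Complex.I • a)

noncomputable instance (a b : E) : IsFiniteMeasure (polarMeasure H a b) := by
  unfold polarMeasure; infer_instance

noncomputable instance (a b : E) : (polarMeasure H a b).Regular := by
  unfold polarMeasure; infer_instance

/-- Polarization expresses the matrix element through four quadratic forms, each bounded by an
integral against its own spectral measure. The factor `1/4` is given away. -/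
lemma norm_inner_borelFC_le {f : ℝ → ℂ} (hf : IsBoundedBorel f) (a b : E) :
    ‖⟪a, borelFC H f b⟫_ℂ‖ ≤ ∫ t, ‖f t‖ ∂(polarMeasure H a b) := by
  have hn : ∀ v, ‖⟪borelFC H f v, v⟫_ℂ‖ ≤ ∫ t, ‖f t‖ ∂(spectralMeasure H v) := fun v => by
    rw [norm_inner_symm, hf.inner_borelFC]
    exact norm_integral_le_integral_norm _
  have hi : ∀ v, Integrable (fun t => ‖f t‖) (spectralMeasure H v) := fun v =>
    (hf.integrable _).norm
  have hm : ∫ t, ‖f t‖ ∂(polarMeasure H a b) = ∫ t, ‖f t‖ ∂(spectralMeasure H (b + a)) +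
      ∫ t, ‖f t‖ ∂(spectralMeasure H (b - a)) + ∫ t, ‖f t‖ ∂(spectralMeasure H (b + Complex.I • a))
      + ∫ t, ‖f t‖ ∂(spectralMeasure H (b - Complex.I • a)) := by
    rw [polarMeasure, integral_add_measure (((hi _).add_measure (hi _)).add_measure (hi _)) (hi _),
      integral_add_measure ((hi _).add_measure (hi _)) (hi _), integral_add_measure (hi _) (hi _)]
  rw [hm, norm_inner_symm]
  have hp := inner_map_polarization' (borelFC H f : E →ₗ[ℂ] E) b a
  simp only [ContinuousLinearMap.coe_coe] at hp
  rw [hp, norm_div]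
  have h4 : ‖(4 : ℂ)‖ = 4 := by simp
  rw [h4]
  have h1 := hn (b + a)
  have h2 := hn (b - a)
  have h3 := hn (b + Complex.I • a)
  have h5 := hn (b - Complex.I • a)
  have n1 := norm_add_le (⟪borelFC H f (b + a), b + a⟫_ℂ - ⟪borelFC H f (b - a), b - a⟫_ℂ -
    Complex.I * ⟪borelFC H f (b + Complex.I • a), b + Complex.I • a⟫_ℂ)
    (Complex.I * ⟪borelFC H f (b - Complex.I • a), b - Complex.I • a⟫_ℂ)
  have n2 := norm_sub_le (⟪borelFC H f (b + a), b + a⟫_ℂ - ⟪borelFC H f (b - a), b - a⟫_ℂ)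
    (Complex.I * ⟪borelFC H f (b + Complex.I • a), b + Complex.I • a⟫_ℂ)
  have n3 := norm_sub_le ⟪borelFC H f (b + a), b + a⟫_ℂ ⟪borelFC H f (b - a), b - a⟫_ℂ
  simp only [norm_mul, Complex.norm_I, one_mul] at n1 n2 n3
  have hb : ∀ x y z w A B C D X : ℝ, x ≤ A → y ≤ B → z ≤ C → w ≤ D → 0 ≤ X → X ≤ x + y + z + w →
    X / 4 ≤ A + B + C + D := by intros; linarith
  refine hb _ _ _ _ _ _ _ _ _ h1 h2 h3 h5 (norm_nonneg _) ?_
  linarith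

lemma exists_compactlySupported_integral_le {f : ℝ → ℝ} (hf : IsBoundedBorel f) (μ : Measure ℝ)
    [IsFiniteMeasure μ] [μ.Regular] {ε : ℝ} (hε : 0 < ε) :
    ∃ g : C_c(ℝ, ℝ), ∫ t, ‖f t - g t‖ ∂μ ≤ ε := by
  obtain ⟨g, hg, h, hc, -⟩ := (hf.integrable μ).exists_hasCompactSupport_integral_sub_le hε
  exact ⟨⟨⟨g, hc⟩, hg⟩, h⟩

/-- `C_c` is dense in `L¹(μ)`, and the hypothesis makes `L` Lipschitz for the `L¹` distance. -/
lemma eq_zero_of_integral_bound {L : (ℝ → ℝ) → ℂ} (μ : Measure ℝ) [IsFiniteMeasure μ]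
    [μ.Regular] (C : ℝ) (hL : ∀ f g : ℝ → ℝ, IsBoundedBorel f → IsBoundedBorel g →
      ‖L f - L g‖ ≤ C * ∫ t, ‖f t - g t‖ ∂μ) (h0 : ∀ g : C_c(ℝ, ℝ), L g = 0)
    {f : ℝ → ℝ} (hf : IsBoundedBorel f) : L f = 0 := by
  rw [← norm_le_zero_iff]
  refine le_of_forall_pos_le_add fun ε hε => ?_
  obtain ⟨g, hg⟩ := exists_compactlySupported_integral_le hf μ
    (show 0 < ε / (|C| + 1) by positivity)
  have h1 := hL f g hf (IsBoundedBorel.of_compactlySupported g)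
  rw [h0, sub_zero] at h1
  have h2 : 0 ≤ ∫ t, ‖f t - g t‖ ∂μ := integral_nonneg fun _ => norm_nonneg _
  calc ‖L f‖ ≤ C * ∫ t, ‖f t - g t‖ ∂μ := h1
    _ ≤ (|C| + 1) * ∫ t, ‖f t - g t‖ ∂μ := by
        gcongr; linarith [le_abs_self C]
    _ ≤ (|C| + 1) * (ε / (|C| + 1)) := by gcongr
    _ = 0 + ε := by field_simp; ring

/-- `⟨a, (f(H) k(H) - (f k)(H)) b⟩`. -/
noncomputable def mulDefect (H : E →L[ℂ] E) (a b : E) (f k : ℝ → ℝ) : ℂ :=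
  ⟪a, borelFC H (fun t => (f t : ℂ)) (borelFC H (fun t => (k t : ℂ)) b)⟫_ℂ
    - ⟪a, borelFC H (fun t => (((f t * k t : ℝ)) : ℂ)) b⟫_ℂ

lemma borelFC_ofReal_sub {f g : ℝ → ℝ} (hf : IsBoundedBorel f) (hg : IsBoundedBorel g) :
    borelFC H (fun t => ((f t : ℝ) : ℂ)) - borelFC H (fun t => ((g t : ℝ) : ℂ))
      = borelFC H (fun t => ((f t - g t : ℝ) : ℂ)) := by
  rw [← borelFC_sub hf.ofReal hg.ofReal]
  simp

lemma norm_inner_borelFC_ofReal_le {f : ℝ → ℝ} (hf : IsBoundedBorel f) (a b : E) :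
    ‖⟪a, borelFC H (fun t => (f t : ℂ)) b⟫_ℂ‖ ≤ ∫ t, ‖f t‖ ∂(polarMeasure H a b) := by
  simpa using norm_inner_borelFC_le (H := H) hf.ofReal a b

lemma integral_norm_mul_le {f k : ℝ → ℝ} (hf : IsBoundedBorel f) (hk : IsBoundedBorel k)
    {C : ℝ} (hC : ∀ t, ‖k t‖ ≤ C) (μ : Measure ℝ) [IsFiniteMeasure μ] :
    ∫ t, ‖f t * k t‖ ∂μ ≤ C * ∫ t, ‖f t‖ ∂μ := by
  rw [← integral_const_mul]
  refine integral_mono ((hf.mul hk).integrable μ).norm ((hf.integrable μ).norm.const_mul C)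
    fun t => ?_
  simp only [norm_mul, mul_comm C]
  exact mul_le_mul_of_nonneg_left (hC t) (norm_nonneg _)

lemma mulDefect_bound {x y : ℂ} {I J K C : ℝ} (hx : ‖x‖ ≤ I) (hy : ‖y‖ ≤ C * J) (hK : K = I + J)
    (hI : 0 ≤ I) (hJ : 0 ≤ J) (hC : 0 ≤ C) : ‖x - y‖ ≤ (1 + C) * K := by
  refine (norm_sub_le _ _).trans ?_
  rw [hK]
  nlinarith

/-- Multiplicativity holds on `C_c` by the continuous functional calculus. It extends to Borel `f`
by `L¹` density, with respect to a measure that dominates the spectral measures at both `(a, h(H)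
b)` and `(a, b)`. -/
lemma mulDefect_of_compactlySupported_right (a b : E) {f : ℝ → ℝ} (hf : IsBoundedBorel f)
    (h : C_c(ℝ, ℝ)) : mulDefect H a b f h = 0 := by
  have hh := IsBoundedBorel.of_compactlySupported h
  obtain ⟨C, hC⟩ := hh.2
  set b' := borelFC H (fun t => (h t : ℂ)) b with hb'
  refine eq_zero_of_integral_bound (L := fun f => mulDefect H a b f h)
    (polarMeasure H a b' + polarMeasure H a b) (1 + C) (fun f g hf hg => ?_) (fun g => ?_) hf
  · have hi : ∀ μ : Measure ℝ, IsFiniteMeasure μ → Integrable (fun t => ‖f t - g t‖) μ :=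
      fun μ _ => ((hf.sub hg).integrable μ).norm
    have e : mulDefect H a b f h - mulDefect H a b g h
        = ⟪a, borelFC H (fun t => ((f t - g t : ℝ) : ℂ)) b'⟫_ℂ
          - ⟪a, borelFC H (fun t => (((f t - g t) * h t : ℝ) : ℂ)) b⟫_ℂ := by
      have e1 := borelFC_ofReal_sub (H := H) (hf.mul hh) (hg.mul hh)
      simp only [← sub_mul] at e1
      rw [← borelFC_ofReal_sub hf hg, ← e1]
      simp only [mulDefect, sub_apply, inner_sub_right, ← hb']
      ring
    simp only [e]
    exact mulDefect_bound (norm_inner_borelFC_ofReal_le (hf.sub hg) a b')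
      ((norm_inner_borelFC_ofReal_le ((hf.sub hg).mul hh) a b).trans
        (integral_norm_mul_le (hf.sub hg) hh hC _))
      (integral_add_measure (hi _ inferInstance) (hi _ inferInstance))
      (integral_nonneg fun _ => norm_nonneg _) (integral_nonneg fun _ => norm_nonneg _)
      ((norm_nonneg _).trans (hC 0))
  · have e : cfc (g : ℝ → ℝ) H * cfc (h : ℝ → ℝ) H = cfc (⇑(g * h)) H := by
      rw [← cfc_mul (a := H) (g : ℝ → ℝ) (h : ℝ → ℝ) g.continuous.continuousOn
        h.continuous.continuousOn]
      rfl
    have e2 := borelFC_compactlySupported (H := H) (g * h)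
    rw [← e] at e2
    simp only [CompactlySupportedContinuousMap.mul_apply] at e2
    simp only [mulDefect, e2, borelFC_compactlySupported, mul_apply_eq_comp, sub_self]

/-- A second density argument, now in the other factor: self-adjointness moves `f(H)` onto `a`, so
that only `k` varies. -/
lemma mulDefect_eq_zero (a b : E) {f k : ℝ → ℝ} (hf : IsBoundedBorel f) (hk : IsBoundedBorel k) :
    mulDefect H a b f k = 0 := by
  obtain ⟨C, hC⟩ := hf.2
  set a' := borelFC H (fun t => (f t : ℂ)) a with ha'
  refine eq_zero_of_integral_bound (L := fun k => mulDefect H a b f k)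
    (polarMeasure H a' b + polarMeasure H a b) (1 + C) (fun k g hk hg => ?_)
    (fun g => mulDefect_of_compactlySupported_right a b hf g) hk
  have hi : ∀ μ : Measure ℝ, IsFiniteMeasure μ → Integrable (fun t => ‖k t - g t‖) μ :=
    fun μ _ => ((hk.sub hg).integrable μ).norm
  have hadj : ∀ v, ⟪a, borelFC H (fun t => (f t : ℂ)) v⟫_ℂ = ⟪a', v⟫_ℂ := fun v => by
    rw [ha', ← ContinuousLinearMap.adjoint_inner_left, ← ContinuousLinearMap.star_eq_adjoint,
      (isSelfAdjoint_borelFC hf).star_eq]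
  have e : mulDefect H a b f k - mulDefect H a b f g
      = ⟪a', borelFC H (fun t => ((k t - g t : ℝ) : ℂ)) b⟫_ℂ
        - ⟪a, borelFC H (fun t => (((k t - g t) * f t : ℝ) : ℂ)) b⟫_ℂ := by
    have e1 := borelFC_ofReal_sub (H := H) (hk.mul hf) (hg.mul hf)
    simp only [← sub_mul] at e1
    rw [← borelFC_ofReal_sub hk hg, ← e1]
    simp only [mulDefect, sub_apply, inner_sub_right, hadj, mul_comm (f _)]
    ring
  simp only [e]
  exact mulDefect_bound (norm_inner_borelFC_ofReal_le (hk.sub hg) a' b)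
    ((norm_inner_borelFC_ofReal_le ((hk.sub hg).mul hf) a b).trans
      (integral_norm_mul_le (hk.sub hg) hf hC _))
    (integral_add_measure (hi _ inferInstance) (hi _ inferInstance))
    (integral_nonneg fun _ => norm_nonneg _) (integral_nonneg fun _ => norm_nonneg _)
    ((norm_nonneg _).trans (hC 0))

lemma borelFC_mul {f k : ℝ → ℝ} (hf : IsBoundedBorel f) (hk : IsBoundedBorel k) :
    borelFC H (fun t => (f t : ℂ)) * borelFC H (fun t => (k t : ℂ))
      = borelFC H (fun t => ((f t * k t : ℝ) : ℂ)) := by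
  ext b
  refine ext_inner_left ℂ fun a => ?_
  exact sub_eq_zero.1 (mulDefect_eq_zero a b hf hk)

/-! ### Spectral projections -/

lemma spectralProjection_eq_borelFC_ofReal (S : Set ℝ) :
    spectralProjection H S = borelFC H (fun t => ((S.indicator (1 : ℝ → ℝ) t : ℝ) : ℂ)) := by
  unfold spectralProjection
  congr 1
  ext t
  by_cases h : t ∈ S <;> simp [h]

lemma spectralProjection_mul {S T : Set ℝ} (hS : MeasurableSet S) (hT : MeasurableSet T) :
    spectralProjection H S * spectralProjection H T = spectralProjection H (S ∩ T) := by
  simp only [spectralProjection_eq_borelFC_ofReal]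
  rw [borelFC_mul (.indicator_one hS) (.indicator_one hT)]
  congr 1
  ext t
  by_cases h : t ∈ S <;> by_cases h' : t ∈ T <;> simp [h, h']

lemma spectralProjection_empty : spectralProjection H (∅ : Set ℝ) = 0 :=
  borelFC_eq_of_forall (.indicator_one MeasurableSet.empty) fun ψ => by simp

lemma isStarProjection_spectralProjection {S : Set ℝ} (hS : MeasurableSet S) :
    IsStarProjection (spectralProjection H S) := by
  refine ⟨?_, ?_⟩
  · rw [IsIdempotentElem, spectralProjection_mul hS hS, Set.inter_self]
  · rw [spectralProjection_eq_borelFC_ofReal]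
    exact isSelfAdjoint_borelFC (.indicator_one hS)

lemma spectralProjection_mul_of_disjoint {S T : Set ℝ} (hS : MeasurableSet S)
    (hT : MeasurableSet T) (h : Disjoint S T) :
    spectralProjection H S * spectralProjection H T = 0 := by
  rw [spectralProjection_mul hS hT, h.inter_eq, spectralProjection_empty]

lemma spectralProjection_union {S T : Set ℝ} (hS : MeasurableSet S)
    (hT : MeasurableSet T) (h : Disjoint S T) :
    spectralProjection H (S ∪ T) = spectralProjection H S + spectralProjection H T := by
  unfold spectralProjection
  rw [Set.indicator_union_of_disjoint h, ← borelFC_add (.indicator_one hS) (.indicator_one hT)]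

lemma norm_spectralProjection_apply_sq {S : Set ℝ} (hS : MeasurableSet S) (ψ : E) :
    ‖spectralProjection H S ψ‖ ^ 2 = (spectralMeasure H ψ).real S := by
  have hP := isStarProjection_spectralProjection (H := H) hS
  have h1 : ⟪ψ, spectralProjection H S ψ⟫_ℂ = ((spectralMeasure H ψ).real S : ℂ) := by
    rw [spectralProjection, (IsBoundedBorel.indicator_one hS).inner_borelFC,
      integral_indicator hS]
    simp
  have h2 : ⟪spectralProjection H S ψ, spectralProjection H S ψ⟫_ℂ
      = ⟪ψ, spectralProjection H S ψ⟫_ℂ := by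
    rw [← ContinuousLinearMap.adjoint_inner_right, ← ContinuousLinearMap.star_eq_adjoint,
      hP.isSelfAdjoint.star_eq, ← mul_apply_eq_comp, hP.isIdempotentElem.eq]
  rw [h1, inner_self_eq_norm_sq_to_K] at h2
  exact Complex.ofReal_injective (by simpa using h2)

/-- Cut the identity function off outside a compact set containing the spectrum. The point `t` is
included in that set because it need not be spectral. -/
lemma exists_borelFC_eq_self (hH : IsSelfAdjoint H) (t : ℝ) :
    ∃ h : C_c(ℝ, ℝ), h t = t ∧ borelFC H (fun s => (h s : ℂ)) = H := by
  have hK : IsCompact ({t} ∪ spectrum ℝ H) :=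
    isCompact_singleton.union (ContinuousFunctionalCalculus.isCompact_spectrum H)
  obtain ⟨g, hg1, -, hgc, -⟩ :=
    exists_continuous_one_zero_of_isCompact (X := ℝ) (t := ∅) hK isClosed_empty (by simp)
  let h : C_c(ℝ, ℝ) := ⟨⟨fun s => s * g s, continuous_id.mul g.continuous⟩, hgc.mul_left⟩
  have hh : ∀ s ∈ {t} ∪ spectrum ℝ H, h s = s := fun s hs => by
    show s * g s = s
    rw [hg1 hs]; simp
  refine ⟨h, hh t (Or.inl rfl), ?_⟩
  rw [borelFC_compactlySupported]
  have e : cfc (h : ℝ → ℝ) H = cfc (id : ℝ → ℝ) H := cfc_congr fun s hs => hh s (Or.inr hs)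
  rw [e, cfc_id ℝ H hH]

lemma mul_spectralProjection_singleton (hH : IsSelfAdjoint H) (t : ℝ) :
    H * spectralProjection H {t} = (t : ℂ) • spectralProjection H {t} := by
  obtain ⟨h, ht, hB⟩ := exists_borelFC_eq_self hH t
  have hm : MeasurableSet {t} := measurableSet_singleton t
  have e : H * spectralProjection H {t} = borelFC H (fun s => (h s : ℂ)) *
      borelFC H (fun s => ((({t} : Set ℝ).indicator (1 : ℝ → ℝ) s : ℝ) : ℂ)) := by
    rw [hB, ← spectralProjection_eq_borelFC_ofReal]
  rw [e, borelFC_mul (.of_compactlySupported h) (.indicator_one hm),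
    spectralProjection_eq_borelFC_ofReal,
    ← borelFC_const_mul (IsBoundedBorel.indicator_one hm).ofReal]
  congr 1
  ext s
  by_cases hs : s = t
  · subst hs; simp [ht]
  · simp [hs]

lemma finiteDimensional_range_spectralProjection (hH : IsSelfAdjoint H) {Λ : Set ℝ}
    (hΛ : Λ.Finite)
    (hfin : ∀ t ∈ Λ, FiniteDimensional ℂ (Module.End.eigenspace (H : Module.End ℂ E) (t : ℂ))) :
    FiniteDimensional ℂ (spectralProjection H Λ).range := by
  induction Λ, hΛ using Set.Finite.induction_on with
  | empty =>
    rw [spectralProjection_empty]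
    have : (0 : E →L[ℂ] E).range = ⊥ := LinearMap.range_zero
    rw [this]; infer_instance
  | @insert t s ht hs ih =>
    rw [Set.insert_eq, spectralProjection_union (measurableSet_singleton t) hs.measurableSet
      (by simpa using ht)]
    have := ih fun u hu => hfin u (by simp [hu])
    have := hfin t (by simp)
    refine Submodule.finiteDimensional_of_le (S₂ := Module.End.eigenspace (H : Module.End ℂ E) (t : ℂ)
      ⊔ (spectralProjection H s).range) ?_
    rintro _ ⟨x, rfl⟩
    refine Submodule.add_mem_sup ?_ ⟨x, rfl⟩
    rw [Module.End.mem_eigenspace_iff]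
    exact congrArg (fun A : E →L[ℂ] E => A x) (mul_spectralProjection_singleton hH t)

end FunctionalCalculus

/-! ### Time reversal commutes with the functional calculus. -/

section TimeReversalCalculus

variable {E : Type*} [NormedAddCommGroup E] [InnerProductSpace ℂ E] [CompleteSpace E]
  {H : E →L[ℂ] E} {Θ : E →ₗ⋆[ℂ] E}

namespace IsQuaternionic

omit [CompleteSpace E] in
lemma norm_map (hΘ : IsQuaternionic Θ) (ψ : E) : ‖Θ ψ‖ = ‖ψ‖ := by
  have h := hΘ.antiunitary ψ ψ
  rw [inner_self_eq_norm_sq_to_K, inner_self_eq_norm_sq_to_K] at h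
  have h2 : ‖Θ ψ‖ ^ 2 = ‖ψ‖ ^ 2 := by exact_mod_cast h
  exact (sq_eq_sq₀ (norm_nonneg _) (norm_nonneg _)).1 h2

omit [CompleteSpace E] in
lemma inner_left (hΘ : IsQuaternionic Θ) (a b : E) : ⟪Θ a, b⟫_ℂ = -⟪Θ b, a⟫_ℂ := by
  rw [← hΘ.antiunitary a (Θ b), hΘ.sq_eq_neg_one, inner_neg_right, neg_neg]

/-- The operator `Θ⁻¹ A Θ = -Θ A Θ`. -/
noncomputable def conj (hΘ : IsQuaternionic Θ) (A : E →L[ℂ] E) : E →L[ℂ] E :=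
  LinearMap.mkContinuous
    { toFun := fun ψ => -Θ (A (Θ ψ))
      map_add' := fun ψ φ => by simp only [map_add]; abel
      map_smul' := fun c ψ => by simp [LinearMap.map_smulₛₗ] } ‖A‖ fun ψ => by
    simp only [LinearMap.coe_mk, AddHom.coe_mk, norm_neg, hΘ.norm_map]
    exact (A.le_opNorm _).trans_eq (by rw [hΘ.norm_map])

omit [CompleteSpace E] in
lemma conj_apply (hΘ : IsQuaternionic Θ) (A : E →L[ℂ] E) (ψ : E) :
    hΘ.conj A ψ = -Θ (A (Θ ψ)) := rfl

/-- Conjugation by an antiunitary map, as a real star algebra homomorphism. -/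
noncomputable def conjHom (hΘ : IsQuaternionic Θ) : (E →L[ℂ] E) →⋆ₐ[ℝ] (E →L[ℂ] E) where
  toFun := hΘ.conj
  map_one' := by ext ψ; simp [conj_apply, hΘ.sq_eq_neg_one]
  map_mul' A B := by ext ψ; simp [conj_apply, hΘ.sq_eq_neg_one]
  map_zero' := by ext ψ; simp [conj_apply]
  map_add' A B := by ext ψ; simp [conj_apply]; abel
  commutes' r := by
    ext ψ
    have h : ∀ φ : E, (algebraMap ℝ (E →L[ℂ] E) r) φ = (r : ℂ) • φ := fun φ => by
      rw [Algebra.algebraMap_eq_smul_one]; simp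
    rw [conj_apply, h, h, LinearMap.map_smulₛₗ, hΘ.sq_eq_neg_one]
    simp
  map_star' A := by
    ext ψ
    refine ext_inner_left ℂ fun φ => ?_
    rw [ContinuousLinearMap.star_eq_adjoint, ContinuousLinearMap.star_eq_adjoint,
      ContinuousLinearMap.adjoint_inner_right]
    show ⟪φ, -Θ (ContinuousLinearMap.adjoint A (Θ ψ))⟫_ℂ = ⟪-Θ (A (Θ φ)), ψ⟫_ℂ
    rw [inner_neg_left, inner_neg_right, hΘ.inner_left (A (Θ φ)), ← inner_conj_symm, hΘ.inner_left,
      map_neg, inner_conj_symm, ContinuousLinearMap.adjoint_inner_left]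

/-- Conjugation by `Θ` is a continuous star homomorphism, over `ℝ` only because `Θ` is antilinear;
this suffices for real functions, and it fixes `H`. -/
lemma commute_cfc (hΘ : IsQuaternionic Θ) (hH : IsSelfAdjoint H) (hHΘ : ∀ ψ, H (Θ ψ) = Θ (H ψ))
    {g : ℝ → ℝ} (hg : Continuous g) (ψ : E) : cfc g H (Θ ψ) = Θ (cfc g H ψ) := by
  have h1 : hΘ.conjHom H = H := by
    ext φ
    show -Θ (H (Θ φ)) = H φ
    rw [hHΘ, hΘ.sq_eq_neg_one, neg_neg]
  have hc : Continuous hΘ.conjHom :=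
    AddMonoidHomClass.continuous_of_bound hΘ.conjHom 1 fun A => by
      rw [one_mul]
      exact ContinuousLinearMap.opNorm_le_bound _ (norm_nonneg _) fun ψ => by
        show ‖-Θ (A (Θ ψ))‖ ≤ _
        rw [norm_neg, hΘ.norm_map]
        exact (A.le_opNorm _).trans_eq (by rw [hΘ.norm_map])
  have h2 := StarAlgHom.map_cfc hΘ.conjHom g H hg.continuousOn hc hH (by rw [h1]; exact hH)
  rw [h1] at h2
  have h3 : -Θ (cfc g H (Θ ψ)) = cfc g H ψ := congrArg (fun A : E →L[ℂ] E => A ψ) h2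
  rw [← h3, map_neg, hΘ.sq_eq_neg_one, neg_neg]

lemma spectralMeasure_map (hΘ : IsQuaternionic Θ) (hH : IsSelfAdjoint H)
    (hHΘ : ∀ ψ, H (Θ ψ) = Θ (H ψ)) (ψ : E) : spectralMeasure H (Θ ψ) = spectralMeasure H ψ := by
  apply Measure.ext_of_integral_eq_on_compactlySupported
  intro g
  have h : cfc (g : ℝ → ℝ) H (Θ ψ) = Θ (cfc (g : ℝ → ℝ) H ψ) :=
    hΘ.commute_cfc hH hHΘ g.continuous ψ
  rw [integral_spectralMeasure, integral_spectralMeasure, h, hΘ.antiunitary, ← inner_conj_symm, Complex.conj_re]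

/-- `ψ` and `Θψ` have the same spectral measure, so the projection and its conjugate by `Θ` have the
same real quadratic form. -/
lemma commute_spectralProjection (hΘ : IsQuaternionic Θ) (hH : IsSelfAdjoint H)
    (hHΘ : ∀ ψ, H (Θ ψ) = Θ (H ψ)) {S : Set ℝ} (hS : MeasurableSet S) (ψ : E) :
    spectralProjection H S (Θ ψ) = Θ (spectralProjection H S ψ) := by
  have h : hΘ.conj (spectralProjection H S) = spectralProjection H S := by
    refine eq_of_forall_inner_self_eq fun φ => ?_
    rw [conj_apply, inner_neg_right, ← inner_conj_symm, hΘ.inner_left, map_neg, neg_neg,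
      inner_conj_symm, ← inner_conj_symm]
    have h1 : ∀ v, ⟪v, spectralProjection H S v⟫_ℂ = ((spectralMeasure H v).real S : ℂ) := by
      intro v
      rw [spectralProjection, (IsBoundedBorel.indicator_one hS).inner_borelFC,
        integral_indicator hS]
      simp
    simp only [h1, hΘ.spectralMeasure_map hH hHΘ, Complex.conj_ofReal]
  have h3 : -Θ (spectralProjection H S (Θ ψ)) = spectralProjection H S ψ :=
    congrArg (fun A : E →L[ℂ] E => A ψ) h
  rw [← h3, map_neg, hΘ.sq_eq_neg_one, neg_neg]

end IsQuaternionic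

end TimeReversalCalculus

/-! ### Matrix elements, the Schur test, the flux phase and time reversal on the lattice. -/

section Lattice

variable {N : ℕ}

lemma matrixElement_apply (A : BulkSpace N →L[ℂ] BulkSpace N) (x y : ℤ × ℤ)
    (v : EuclideanSpace ℂ (Fin N)) : matrixElement A x y v = A (lp.single 2 y v) x := rfl

lemma norm_lp_sq (ψ : BulkSpace N) : HasSum (fun x => ‖ψ x‖ ^ 2) (‖ψ‖ ^ 2) := by
  simpa using lp.hasSum_norm (p := 2) (by simp) ψ

lemma sum_norm_sq_le (ψ : BulkSpace N) (F : Finset (ℤ × ℤ)) : ∑ x ∈ F, ‖ψ x‖ ^ 2 ≤ ‖ψ‖ ^ 2 :=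
  sum_le_hasSum F (fun _ _ => sq_nonneg _) (norm_lp_sq ψ)

lemma norm_matrixElement_le_single (A : BulkSpace N →L[ℂ] BulkSpace N) (x y : ℤ × ℤ)
    (v : EuclideanSpace ℂ (Fin N)) : ‖matrixElement A x y v‖ ≤ ‖A (lp.single 2 y v)‖ := by
  rw [matrixElement_apply]
  exact lp.norm_apply_le_norm (by simp) _ _

lemma norm_matrixElement_le (A : BulkSpace N →L[ℂ] BulkSpace N) (x y : ℤ × ℤ) :
    ‖matrixElement A x y‖ ≤ ‖A‖ := by
  refine ContinuousLinearMap.opNorm_le_bound _ (norm_nonneg _) fun v => ?_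
  refine (norm_matrixElement_le_single A x y v).trans ((A.le_opNorm _).trans_eq ?_)
  rw [lp.norm_single (by simp)]

/-- **Schur test** for operators on the lattice with a symmetric kernel. -/
theorem norm_le_of_symmetric_kernel (A : BulkSpace N →L[ℂ] BulkSpace N) (k : ℤ × ℤ → ℤ × ℤ → ℝ)
    (hk : ∀ x y, ‖matrixElement A x y‖ ≤ k x y) (hsymm : ∀ x y, k x y = k y x) {c : ℝ}
    (hrow : ∀ x (F : Finset (ℤ × ℤ)), ∑ y ∈ F, k x y ≤ c) : ‖A‖ ≤ c := by
  have hk0 : ∀ x y, 0 ≤ k x y := fun x y => (norm_nonneg _).trans (hk x y)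
  have hc : 0 ≤ c := by simpa using hrow 0 ∅
  let tr : BulkSpace N → Finset (ℤ × ℤ) → BulkSpace N := fun ψ F => ∑ x ∈ F, lp.single 2 x (ψ x)
  have htr : ∀ ψ, Tendsto (tr ψ) atTop (𝓝 ψ) := fun ψ => lp.hasSum_single (by simp) ψ
  have hfin : ∀ (F : Finset (ℤ × ℤ)) (φ ψ : BulkSpace N),
      ‖⟪tr φ F, A (tr ψ F)⟫_ℂ‖ ≤ c / 2 * (‖φ‖ ^ 2 + ‖ψ‖ ^ 2) := by
    intro F φ ψ
    have e : ⟪tr φ F, A (tr ψ F)⟫_ℂ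
        = ∑ x ∈ F, ∑ y ∈ F, ⟪φ x, matrixElement A x y (ψ y)⟫_ℂ := by
      simp only [tr, map_sum, sum_inner, inner_sum, lp.inner_single_left, matrixElement_apply]
      exact Finset.sum_comm
    have h1 : ∑ x ∈ F, ∑ y ∈ F, k x y * ‖φ x‖ ^ 2 ≤ c * ‖φ‖ ^ 2 := by
      calc ∑ x ∈ F, ∑ y ∈ F, k x y * ‖φ x‖ ^ 2 = ∑ x ∈ F, (∑ y ∈ F, k x y) * ‖φ x‖ ^ 2 := by
            simp only [Finset.sum_mul]
        _ ≤ ∑ x ∈ F, c * ‖φ x‖ ^ 2 := by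
            gcongr with x _
            exact hrow x F
        _ ≤ c * ‖φ‖ ^ 2 := by
            rw [← Finset.mul_sum]
            exact mul_le_mul_of_nonneg_left (sum_norm_sq_le φ F) hc
    have h2 : ∑ x ∈ F, ∑ y ∈ F, k x y * ‖ψ y‖ ^ 2 ≤ c * ‖ψ‖ ^ 2 := by
      calc ∑ x ∈ F, ∑ y ∈ F, k x y * ‖ψ y‖ ^ 2 = ∑ y ∈ F, (∑ x ∈ F, k y x) * ‖ψ y‖ ^ 2 := by
            rw [Finset.sum_comm]
            simp only [Finset.sum_mul, hsymm]
        _ ≤ ∑ y ∈ F, c * ‖ψ y‖ ^ 2 := by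
            gcongr with y _
            exact hrow y F
        _ ≤ c * ‖ψ‖ ^ 2 := by
            rw [← Finset.mul_sum]
            exact mul_le_mul_of_nonneg_left (sum_norm_sq_le ψ F) hc
    rw [e]
    calc ‖∑ x ∈ F, ∑ y ∈ F, ⟪φ x, matrixElement A x y (ψ y)⟫_ℂ‖
        ≤ ∑ x ∈ F, ∑ y ∈ F, ‖⟪φ x, matrixElement A x y (ψ y)⟫_ℂ‖ :=
          (norm_sum_le _ _).trans (Finset.sum_le_sum fun x _ => norm_sum_le _ _)
      -- The inequality `2ab ≤ a² + b²` separates the two vectors; each half is then a row sum, by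
      -- symmetry of the kernel.
      _ ≤ ∑ x ∈ F, ∑ y ∈ F, (k x y * ‖φ x‖ ^ 2 / 2 + k x y * ‖ψ y‖ ^ 2 / 2) := by
          gcongr with x _ y _
          have h3 : ‖matrixElement A x y (ψ y)‖ ≤ k x y * ‖ψ y‖ :=
            ContinuousLinearMap.le_of_opNorm_le _ (hk x y) _
          have h4 := norm_inner_le_norm (𝕜 := ℂ) (φ x) (matrixElement A x y (ψ y))
          have h5 : ‖φ x‖ * ‖matrixElement A x y (ψ y)‖ ≤ ‖φ x‖ * (k x y * ‖ψ y‖) :=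
            mul_le_mul_of_nonneg_left h3 (norm_nonneg _)
          nlinarith [mul_nonneg (hk0 x y) (sq_nonneg (‖φ x‖ - ‖ψ y‖))]
      _ ≤ c / 2 * (‖φ‖ ^ 2 + ‖ψ‖ ^ 2) := by
          simp only [Finset.sum_add_distrib, ← Finset.sum_div]
          linarith
  have hlim : ∀ φ ψ : BulkSpace N, ‖⟪φ, A ψ⟫_ℂ‖ ≤ c / 2 * (‖φ‖ ^ 2 + ‖ψ‖ ^ 2) := fun φ ψ =>
    le_of_tendsto (((htr φ).inner ((A.continuous.tendsto _).comp (htr ψ))).norm)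
      (Eventually.of_forall fun F => hfin F φ ψ)
  refine ContinuousLinearMap.opNorm_le_bound _ hc fun ψ => ?_
  rcases eq_or_ne (A ψ) 0 with h0 | h0
  · rw [h0, norm_zero]; positivity
  rcases eq_or_ne ψ 0 with h0' | h0'
  · simp [h0']
  have hb : 0 < ‖A ψ‖ := norm_pos_iff.2 h0
  have ha : 0 < ‖ψ‖ := norm_pos_iff.2 h0'
  -- Rescaling `A ψ` to the length of `ψ` makes the two squares in the bound equal, which recovers
  -- the sharp constant `c`.
  have h1 := hlim (((‖ψ‖ / ‖A ψ‖ : ℝ) : ℂ) • A ψ) ψ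
  rw [inner_smul_left, norm_mul, norm_smul, inner_self_eq_norm_sq_to_K] at h1
  simp only [Complex.norm_real, RCLike.norm_conj, norm_pow, Complex.coe_algebraMap, norm_div,
    norm_norm] at h1
  have e1 : ‖ψ‖ / ‖A ψ‖ * ‖A ψ‖ = ‖ψ‖ := by field_simp
  have e2 : ‖ψ‖ / ‖A ψ‖ * ‖A ψ‖ ^ 2 = ‖ψ‖ * ‖A ψ‖ := by field_simp
  rw [e1, e2] at h1
  have h2 : ‖ψ‖ * ‖A ψ‖ ≤ ‖ψ‖ * (c * ‖ψ‖) := by linarith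
  exact le_of_mul_le_mul_left h2 ha

/-! ### The lattice sums -/

lemma summable_lattice_decay : Summable fun y : ℤ × ℤ => ((1 + ‖y‖) ^ 4)⁻¹ := by
  have h1 : Summable fun n : ℤ => ((1 + |(n : ℝ)|) ^ 2)⁻¹ := by
    -- The comparison fails at `n = 0`, where `1 / n ^ 2` takes the value `0`; one exceptional point
    -- is harmless.
    refine Summable.of_norm_bounded_eventually
      (Real.summable_one_div_int_pow.2 (one_lt_two)) ?_
    refine (Set.finite_singleton (0 : ℤ)).subset fun n hn => ?_
    by_contra h0
    refine hn ?_
    show ‖((1 + |(n : ℝ)|) ^ 2)⁻¹‖ ≤ 1 / (n : ℝ) ^ 2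
    have h1 : 0 < |(n : ℝ)| := abs_pos.2 (by exact_mod_cast h0)
    rw [norm_inv, norm_pow, Real.norm_eq_abs, abs_of_nonneg (by positivity), one_div,
      ← sq_abs (n : ℝ)]
    gcongr
    linarith
  refine Summable.of_nonneg_of_le (fun y => by positivity) (fun y => ?_)
    (h1.mul_of_nonneg h1 (fun _ => by positivity) (fun _ => by positivity))
  rw [← mul_inv]
  have e1 : |(y.1 : ℝ)| ≤ ‖y‖ := by
    rw [Prod.norm_def]; exact le_max_of_le_left (by rw [Int.norm_eq_abs])
  have e2 : |(y.2 : ℝ)| ≤ ‖y‖ := by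
    rw [Prod.norm_def]; exact le_max_of_le_right (by rw [Int.norm_eq_abs])
  have : (1 + |(y.1 : ℝ)|) ^ 2 * (1 + |(y.2 : ℝ)|) ^ 2 ≤ (1 + ‖y‖) ^ 2 * (1 + ‖y‖) ^ 2 := by
    gcongr
  gcongr
  calc _ ≤ _ := this
    _ = _ := by ring

/-- The sum of `(1 + ‖y‖)⁻⁴` over the lattice. -/
noncomputable def latticeSum : ℝ := ∑' y : ℤ × ℤ, ((1 + ‖y‖) ^ 4)⁻¹

lemma sum_lattice_decay_le (x : ℤ × ℤ) (F : Finset (ℤ × ℤ)) :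
    ∑ y ∈ F, ((1 + ‖x - y‖) ^ 4)⁻¹ ≤ latticeSum := by
  have h := (Equiv.subLeft x).summable_iff.2 summable_lattice_decay
  have e : ∑' y, ((1 + ‖x - y‖) ^ 4)⁻¹ = latticeSum :=
    (Equiv.subLeft x).tsum_eq fun y : ℤ × ℤ => ((1 + ‖y‖) ^ 4)⁻¹
  rw [← e]
  exact Summable.sum_le_tsum F (fun _ _ => by positivity) h

/-! ### The flux insertion -/

/-- The phase `exp(i arg(x₁ + i x₂))`. -/
noncomputable def fluxPhase (x : ℤ × ℤ) : ℂ :=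
  Complex.exp (Complex.I * Complex.arg ((x.1 : ℂ) + Complex.I * (x.2 : ℂ)))

lemma fluxInsertion_apply (ψ : BulkSpace N) (x : ℤ × ℤ) :
    fluxInsertion N ψ x = fluxPhase x • ψ x := rfl

lemma norm_fluxPhase (x : ℤ × ℤ) : ‖fluxPhase x‖ = 1 := by
  rw [fluxPhase, mul_comm Complex.I, Complex.norm_exp_ofReal_mul_I]

lemma fluxPhase_mul_conj (x : ℤ × ℤ) : fluxPhase x * starRingEnd ℂ (fluxPhase x) = 1 := by
  rw [Complex.mul_conj, Complex.normSq_eq_norm_sq, norm_fluxPhase]; simp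

lemma apply_eq_of_inner_single {φ : BulkSpace N} {x : ℤ × ℤ} {w : EuclideanSpace ℂ (Fin N)}
    (h : ∀ v : EuclideanSpace ℂ (Fin N), ⟪(lp.single 2 x v : BulkSpace N), φ⟫_ℂ = ⟪v, w⟫_ℂ) :
    φ x = w :=
  ext_inner_left ℂ fun v => (lp.inner_single_left x v φ).symm.trans (h v)

lemma star_fluxInsertion_apply (ψ : BulkSpace N) (x : ℤ × ℤ) :
    (star (fluxInsertion N)) ψ x = starRingEnd ℂ (fluxPhase x) • ψ x := by
  refine apply_eq_of_inner_single fun v => ?_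
  rw [ContinuousLinearMap.star_eq_adjoint,
    ContinuousLinearMap.adjoint_inner_right, inner_smul_right]
  have : fluxInsertion N (lp.single 2 x v) = fluxPhase x • lp.single 2 x v := by
    ext y
    rw [fluxInsertion_apply]
    by_cases h : y = x
    · subst h; simp
    · simp [h]
  rw [this, inner_smul_left, lp.inner_single_left]

lemma fluxInsertion_mem_unitary : fluxInsertion N ∈ unitary (BulkSpace N →L[ℂ] BulkSpace N) := by
  rw [Unitary.mem_iff]
  constructor
  · ext ψ x
    rw [mul_apply_eq_comp, star_fluxInsertion_apply, fluxInsertion_apply, smul_smul, mul_comm,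
      fluxPhase_mul_conj]
    simp
  · ext ψ x
    rw [mul_apply_eq_comp, fluxInsertion_apply, star_fluxInsertion_apply, smul_smul,
      fluxPhase_mul_conj]
    simp

lemma norm_matrixElement_commutator_fluxInsertion (P : BulkSpace N →L[ℂ] BulkSpace N)
    (x y : ℤ × ℤ) : ‖matrixElement (P * fluxInsertion N - fluxInsertion N * P) x y‖
      = ‖fluxPhase x - fluxPhase y‖ * ‖matrixElement P x y‖ := by
  have : matrixElement (P * fluxInsertion N - fluxInsertion N * P) x y
      = (fluxPhase y - fluxPhase x) • matrixElement P x y := by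
    ext1 v
    have h : fluxInsertion N (lp.single 2 y v) = fluxPhase y • lp.single 2 y v := by
      ext z
      rw [fluxInsertion_apply]
      by_cases h : z = y
      · subst h; simp
      · simp [h]
    rw [matrixElement_apply, sub_apply, mul_apply_eq_comp, mul_apply_eq_comp, h, map_smul,
      smul_apply, matrixElement_apply, sub_smul, lp.coeFn_sub, Pi.sub_apply, fluxInsertion_apply]
    rfl
  rw [this, norm_smul, norm_sub_rev]

lemma norm_fluxPhase_sub_le_two (x y : ℤ × ℤ) : ‖fluxPhase x - fluxPhase y‖ ≤ 2 := by
  refine (norm_sub_le _ _).trans ?_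
  rw [norm_fluxPhase, norm_fluxPhase]; norm_num

/-- The point `x₁ + i x₂` of the complex plane. -/
noncomputable def latticePoint (x : ℤ × ℤ) : ℂ := (x.1 : ℂ) + Complex.I * (x.2 : ℂ)

lemma fluxPhase_mul_norm (x : ℤ × ℤ) : fluxPhase x * ‖latticePoint x‖ = latticePoint x := by
  rw [fluxPhase, mul_comm, mul_comm Complex.I]
  exact Complex.norm_mul_exp_arg_mul_I _

lemma norm_le_norm_latticePoint (x : ℤ × ℤ) : ‖x‖ ≤ ‖latticePoint x‖ := by
  rw [Prod.norm_def, Int.norm_eq_abs, Int.norm_eq_abs]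
  have h1 := Complex.abs_re_le_norm (latticePoint x)
  have h2 := Complex.abs_im_le_norm (latticePoint x)
  simp [latticePoint] at h1 h2 ⊢
  exact ⟨h1, h2⟩

lemma norm_latticePoint_le (x : ℤ × ℤ) : ‖latticePoint x‖ ≤ 2 * ‖x‖ := by
  have h1 : ‖(x.1 : ℂ)‖ ≤ ‖x‖ := by
    rw [Prod.norm_def]; exact le_max_of_le_left (by simp [Int.norm_eq_abs])
  have h2 : ‖Complex.I * (x.2 : ℂ)‖ ≤ ‖x‖ := by
    rw [Prod.norm_def]; exact le_max_of_le_right (by simp [Int.norm_eq_abs])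
  exact (norm_add_le _ _).trans (by linarith)

lemma one_le_norm_of_ne_zero {x : ℤ × ℤ} (hx : x ≠ 0) : 1 ≤ ‖x‖ := by
  rw [Prod.norm_def, Int.norm_eq_abs, Int.norm_eq_abs]
  by_contra! h
  rw [max_lt_iff] at h
  apply hx
  obtain ⟨h1, h2⟩ := h
  norm_cast at h1 h2
  rw [Int.abs_lt_one_iff] at h1 h2
  exact Prod.ext h1 h2

/-- With `z` the complex position, `(u_x - u_y)|z_x| = z_{x-y} + u_y (|z_y| - |z_x|)` has norm at
most `2|z_{x-y}| ≤ 4‖x - y‖`. A further factor 2 comes from `1 + ‖x‖ ≤ 2‖x‖` for `x ≠ 0`; at the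
origin the trivial bound 2 suffices, as distinct sites are at distance at least 1. -/
lemma norm_fluxPhase_sub_le (x y : ℤ × ℤ) :
    ‖fluxPhase x - fluxPhase y‖ * (1 + ‖x‖) ≤ 8 * ‖x - y‖ := by
  rcases eq_or_ne x y with rfl | hxy
  · simp
  have hd := one_le_norm_of_ne_zero (sub_ne_zero.2 hxy)
  rcases eq_or_ne x 0 with rfl | hx
  · have := norm_fluxPhase_sub_le_two 0 y
    rw [norm_zero]
    linarith
  have hx1 := one_le_norm_of_ne_zero hx
  have h1 : (fluxPhase x - fluxPhase y) * ‖latticePoint x‖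
      = latticePoint (x - y) + fluxPhase y * ((‖latticePoint y‖ - ‖latticePoint x‖ : ℝ) : ℂ) := by
    have e : latticePoint (x - y) = latticePoint x - latticePoint y := by
      simp [latticePoint]; ring
    rw [e, sub_mul, fluxPhase_mul_norm]
    push_cast
    rw [mul_sub, fluxPhase_mul_norm]
    ring
  have h2 : ‖fluxPhase x - fluxPhase y‖ * ‖latticePoint x‖ ≤ 2 * ‖latticePoint (x - y)‖ := by
    have h3 := congrArg norm h1
    rw [norm_mul, Complex.norm_real, norm_norm] at h3
    rw [h3]
    refine (norm_add_le _ _).trans ?_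
    rw [norm_mul, norm_fluxPhase, one_mul, Complex.norm_real, two_mul]
    gcongr
    have e : latticePoint (x - y) = latticePoint x - latticePoint y := by
      simp [latticePoint]; ring
    rw [e, norm_sub_rev]
    exact abs_norm_sub_norm_le _ _
  have h4 := norm_latticePoint_le (x - y)
  have h5 := norm_le_norm_latticePoint x
  nlinarith [norm_nonneg (fluxPhase x - fluxPhase y)]

/-! ### Time reversal -/

lemma IsTimeReversal.isQuaternionic {Θ : BulkSpace N →ₗ⋆[ℂ] BulkSpace N} (hΘ : IsTimeReversal Θ) :
    IsQuaternionic Θ := ⟨hΘ.antiunitary, hΘ.sq_eq_neg_one⟩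

/-- Coordinates are real, so they pass through the antilinear `Θ`: the image of a vector at `x` is a
joint eigenvector of the positions with eigenvalues `x₁, x₂`, hence supported at `x`. -/
lemma IsTimeReversal.single_apply_of_ne {Θ : BulkSpace N →ₗ⋆[ℂ] BulkSpace N}
    (hΘ : IsTimeReversal Θ) {x y : ℤ × ℤ} (hxy : y ≠ x) (v : EuclideanSpace ℂ (Fin N)) :
    Θ (lp.single 2 x v) y = 0 := by
  have hs : ∀ c : ℤ, Θ ((c : ℂ) • lp.single 2 x v) y = (c : ℂ) • Θ (lp.single 2 x v) y := by
    intro c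
    rw [LinearMap.map_smulₛₗ, lp.coeFn_smul, Pi.smul_apply, map_intCast]
  have h1 := hΘ.comm_position_one (lp.single 2 x v) ((x.1 : ℂ) • lp.single 2 x v) (fun z => by
    by_cases h : z = x
    · subst h; simp
    · simp [h]) y
  have h2 := hΘ.comm_position_two (lp.single 2 x v) ((x.2 : ℂ) • lp.single 2 x v) (fun z => by
    by_cases h : z = x
    · subst h; simp
    · simp [h]) y
  rw [hs] at h1 h2
  by_contra hne
  have h3 := smul_left_injective ℂ hne h1
  have h4 := smul_left_injective ℂ hne h2
  exact hxy (Prod.ext (by exact_mod_cast h3.symm) (by exact_mod_cast h4.symm))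

/-- `Θ` acts site by site: if `φ` vanishes at `x`, pairing `Θφ` with a vector at `x` reduces by
antiunitarity to pairing `φ` with a vector supported at `x`. -/
lemma IsTimeReversal.apply_eq {Θ : BulkSpace N →ₗ⋆[ℂ] BulkSpace N}
    (hΘ : IsTimeReversal Θ) (ψ : BulkSpace N) (x : ℤ × ℤ) :
    Θ ψ x = Θ (lp.single 2 x (ψ x)) x := by
  have key : ∀ φ : BulkSpace N, φ x = 0 → Θ φ x = 0 := by
    intro φ hφ
    refine apply_eq_of_inner_single fun v => ?_
    rw [← inner_conj_symm, hΘ.isQuaternionic.inner_left]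
    have h0 : ⟪Θ (lp.single 2 x v), φ⟫_ℂ = 0 := by
      rw [lp.inner_eq_tsum]
      refine (tsum_congr fun y => ?_).trans tsum_zero
      by_cases h : y = x
      · subst h; simp [hφ]
      · rw [hΘ.single_apply_of_ne h, inner_zero_left]
    rw [h0]; simp
  have h := key (ψ - lp.single 2 x (ψ x)) (by simp)
  rw [map_sub, lp.coeFn_sub, Pi.sub_apply, sub_eq_zero] at h
  exact h

lemma IsTimeReversal.star_fluxInsertion {Θ : BulkSpace N →ₗ⋆[ℂ] BulkSpace N}
    (hΘ : IsTimeReversal Θ) (ψ : BulkSpace N) :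
    star (fluxInsertion N) (Θ ψ) = Θ (fluxInsertion N ψ) := by
  ext1
  funext x
  rw [star_fluxInsertion_apply, hΘ.apply_eq ψ, hΘ.apply_eq (fluxInsertion N ψ),
    fluxInsertion_apply, lp.single_smul, LinearMap.map_smulₛₗ]
  rfl

end Lattice

/-! ### Partitions into pieces of small measure. -/

section Measures

lemma finite_setOf_le_measure_singleton (μ : Measure ℝ) [IsFiniteMeasure μ] {δ : ENNReal}
    (hδ : 0 < δ) : {t : ℝ | δ ≤ μ {t}}.Finite := by
  refine Measure.finite_const_le_meas_of_disjoint_iUnion μ hδ (As := fun t : ℝ => {t})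
    (fun t => measurableSet_singleton t) (fun s t hst => by simpa using hst) ?_
  exact measure_ne_top μ _

/-- Outer regularity gives each point an open neighbourhood meeting `T` in mass at most `δ`.
Countably many of these cover the line, and they are then made disjoint. -/
lemma exists_partition_measure_le (μ : Measure ℝ) [IsFiniteMeasure μ] {T : Set ℝ}
    (hT : MeasurableSet T) {δ : ENNReal} (hδ : ∀ t ∈ T, μ {t} < δ) (hδ0 : 0 < δ) :
    ∃ A : ℕ → Set ℝ, (∀ n, MeasurableSet (A n)) ∧ Pairwise (Function.onFun Disjoint A) ∧
      (⋃ n, A n) = T ∧ ∀ n, μ (A n) ≤ δ := by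
  have hV : ∀ t : ℝ, ∃ V, IsOpen V ∧ t ∈ V ∧ μ (V ∩ T) ≤ δ := by
    intro t
    have h1 : (μ.restrict T) {t} < δ := by
      rw [Measure.restrict_apply (measurableSet_singleton t)]
      by_cases ht : t ∈ T
      · exact (measure_mono Set.inter_subset_left).trans_lt (hδ t ht)
      · have : ({t} ∩ T : Set ℝ) = ∅ := by
          ext s; simp only [Set.mem_inter_iff, Set.mem_singleton_iff, Set.mem_empty_iff_false,
            iff_false, not_and]
          rintro rfl; exact ht
        rw [this, measure_empty]; exact hδ0
    obtain ⟨V, htV, hVo, hVlt⟩ := Set.exists_isOpen_lt_of_lt _ _ h1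
    refine ⟨V, hVo, htV rfl, ?_⟩
    rw [← Measure.restrict_apply hVo.measurableSet]
    exact hVlt.le
  choose V hVo htV hVδ using hV
  obtain ⟨s, hs, hsU⟩ := TopologicalSpace.countable_cover_nhds fun t => (hVo t).mem_nhds (htV t)
  have hsn : s.Nonempty := by
    by_contra h
    rw [Set.not_nonempty_iff_eq_empty] at h
    rw [h, Set.biUnion_empty] at hsU
    exact Set.empty_ne_univ hsU
  obtain ⟨f, rfl⟩ := hs.exists_eq_range hsn
  refine ⟨disjointed (fun n => V (f n) ∩ T), fun n => ?_, disjoint_disjointed _, ?_, fun n => ?_⟩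
  · exact MeasurableSet.disjointed (fun n => (hVo _).measurableSet.inter hT) n
  · rw [iUnion_disjointed, ← Set.iUnion_inter]
    rw [Set.biUnion_range] at hsU
    rw [hsU, Set.univ_inter]
  · exact (measure_mono (disjointed_subset _ n)).trans (hVδ _)

end Measures

/-! ### Spectral measures of site vectors in a mobility gap. -/

section Localization

variable {N : ℕ} {H : BulkSpace N →L[ℂ] BulkSpace N} {Δ : Set ℝ}

/-- The points of `Δ` other than its endpoints. -/
def gapInterior (Δ : Set ℝ) : Set ℝ := Δ \ (lowerBounds Δ ∪ upperBounds Δ)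

/-- Avoiding the bounds of `Δ` makes the step function vanish there, which gives the required
constancy; disjointness keeps it bounded by 1. -/
lemma sum_indicator_mem_borelOne {ι : Type*} (s : Finset ι) {T : ι → Set ℝ}
    (hT : ∀ i, MeasurableSet (T i)) (hTΔ : ∀ i, T i ⊆ gapInterior Δ)
    (hd : Pairwise (Function.onFun Disjoint T)) {c : ι → ℂ} (hc : ∀ i, ‖c i‖ ≤ 1) :
    (fun t => ∑ i ∈ s, c i * (T i).indicator 1 t) ∈ borelOne Δ := by
  have h0 : ∀ t, t ∈ lowerBounds Δ ∪ upperBounds Δ → ∑ i ∈ s, c i * (T i).indicator 1 t = 0 := by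
    intro t ht
    refine Finset.sum_eq_zero fun i _ => ?_
    rw [Set.indicator_of_notMem fun h => (hTΔ i h).2 ht, mul_zero]
  refine ⟨(IsBoundedBorel.sum s fun i _ => (IsBoundedBorel.indicator_one (hT i)).const_mul _).1,
    fun t => ?_, ⟨0, fun t ht => h0 t (Or.inl ht)⟩, ⟨0, fun t ht => h0 t (Or.inr ht)⟩⟩
  beta_reduce
  by_cases h : ∃ j, t ∈ T j
  · obtain ⟨j, hj⟩ := h
    have hne : ∀ i, i ≠ j → c i * (T i).indicator 1 t = 0 := fun i hi => by
      rw [Set.indicator_of_notMem fun h => Set.disjoint_left.1 (hd hi) h hj, mul_zero]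
    by_cases hjs : j ∈ s
    · rw [Finset.sum_eq_single j (fun i _ hi => hne i hi) (fun h => absurd hjs h)]
      simpa [hj] using hc j
    · rw [Finset.sum_eq_zero fun i hi => hne i (by rintro rfl; exact hjs hi)]
      simp
  · push Not at h
    rw [Finset.sum_eq_zero fun i _ => by rw [Set.indicator_of_notMem (h i), mul_zero]]
    simp

lemma indicator_mem_borelOne {T : Set ℝ} (hT : MeasurableSet T) (hTΔ : T ⊆ gapInterior Δ) :
    T.indicator 1 ∈ borelOne Δ := by
  have := sum_indicator_mem_borelOne (Δ := Δ) (Finset.univ : Finset Unit) (fun _ => hT)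
    (fun _ => hTΔ) (fun i j hij => (hij (Subsingleton.elim _ _)).elim) (c := fun _ => 1) (by simp)
  simpa using this

/-- A convenient normal form: every decay exponent is reached by lowering a larger one, and `ν`, `C`
are raised to at least 1 for the later `ν`-th power argument. -/
lemma IsMobilityGap.exists_bound (hΔ : IsMobilityGap H Δ) :
    ∃ ν : ℕ, 1 ≤ ν ∧ ∀ m : ℕ, ∃ C : ℝ, 1 ≤ C ∧ ∀ f ∈ borelOne Δ, ∀ x y : ℤ × ℤ,
      ‖matrixElement (borelFC H f) x y‖ ≤ C * ((1 + ‖x - y‖) ^ m)⁻¹ * (1 + ‖x‖) ^ ν := by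
  obtain ⟨ν, hν⟩ := hΔ.weaklyLocal
  refine ⟨ν + 1, by omega, fun m => ?_⟩
  obtain ⟨k, ⟨C, hC⟩, hk⟩ := (hν.and (eventually_ge_atTop m)).exists
  refine ⟨max C 1, le_max_right _ _, fun f hf x y => ?_⟩
  refine (hC _ ⟨f, hf, rfl⟩ x y).trans ?_
  have h1 : (1 + ‖x - y‖) ^ (-(k : ℤ)) ≤ ((1 + ‖x - y‖) ^ m)⁻¹ := by
    rw [zpow_neg, zpow_natCast]
    gcongr
    linarith [norm_nonneg (x - y)]
  have h2 : (1 + ‖x‖) ^ ν ≤ (1 + ‖x‖) ^ (ν + 1) :=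
    pow_le_pow_right₀ (by linarith [norm_nonneg x]) (by omega)
  gcongr
  exact le_max_left _ _

lemma exists_norm_le_one_mul_eq_norm (z : ℂ) : ∃ c : ℂ, ‖c‖ ≤ 1 ∧ c * z = ‖z‖ := by
  rcases eq_or_ne z 0 with rfl | hz
  · exact ⟨0, by simp, by simp⟩
  · refine ⟨starRingEnd ℂ z / ‖z‖, ?_, ?_⟩
    · rw [norm_div, RCLike.norm_conj, Complex.norm_real, norm_norm, div_self (norm_ne_zero_iff.2 hz)]
    · have : (‖z‖ : ℂ) ≠ 0 := by exact_mod_cast norm_ne_zero_iff.2 hz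
      rw [div_mul_eq_mul_div, Complex.conj_mul', sq, mul_div_assoc, div_self this, mul_one]

lemma norm_le_sum_norm_coord (w : EuclideanSpace ℂ (Fin N)) : ‖w‖ ≤ ∑ b, ‖w b‖ := by
  rw [EuclideanSpace.norm_eq]
  refine Real.sqrt_le_iff.2 ⟨Finset.sum_nonneg fun _ _ => norm_nonneg _, ?_⟩
  exact Finset.sum_sq_le_sq_sum_of_nonneg fun _ _ => norm_nonneg _

/-- For each coordinate `b`, choose coefficients `c i` that rotate every term onto the positive
axis. The sum of absolute values is then one coordinate of one matrix element of `f(H)`, with `f = ∑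
c i χ_{T i}` in `borelOne Δ`. The factor `N` counts coordinates. -/
lemma sum_norm_matrixElement_le {ι : Type*} (s : Finset ι) {T : ι → Set ℝ}
    (hT : ∀ i, MeasurableSet (T i)) (hTΔ : ∀ i, T i ⊆ gapInterior Δ)
    (hd : Pairwise (Function.onFun Disjoint T)) {x y : ℤ × ℤ} {M : ℝ}
    (hM : ∀ f ∈ borelOne Δ, ‖matrixElement (borelFC H f) x y‖ ≤ M)
    (v : EuclideanSpace ℂ (Fin N)) :
    ∑ i ∈ s, ‖matrixElement (spectralProjection H (T i)) x y v‖ ≤ N * (M * ‖v‖) := by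
  calc ∑ i ∈ s, ‖matrixElement (spectralProjection H (T i)) x y v‖
      ≤ ∑ i ∈ s, ∑ b, ‖matrixElement (spectralProjection H (T i)) x y v b‖ :=
        Finset.sum_le_sum fun i _ => norm_le_sum_norm_coord _
    _ = ∑ b, ∑ i ∈ s, ‖matrixElement (spectralProjection H (T i)) x y v b‖ := Finset.sum_comm
    _ ≤ ∑ _b : Fin N, M * ‖v‖ := by
        refine Finset.sum_le_sum fun b _ => ?_
        choose c hc1 hc2 using fun i =>
          exists_norm_le_one_mul_eq_norm (matrixElement (spectralProjection H (T i)) x y v b)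
        have hf := sum_indicator_mem_borelOne s hT hTΔ hd hc1
        have hB : borelFC H (fun t => ∑ i ∈ s, c i * (T i).indicator 1 t)
            = ∑ i ∈ s, c i • spectralProjection H (T i) := by
          rw [borelFC_sum s fun i _ => (IsBoundedBorel.indicator_one (hT i)).const_mul (c i)]
          exact Finset.sum_congr rfl fun i _ => borelFC_const_mul (.indicator_one (hT i)) _
        have h1 : matrixElement (borelFC H (fun t => ∑ i ∈ s, c i * (T i).indicator 1 t)) x y v b
            = ((∑ i ∈ s, ‖matrixElement (spectralProjection H (T i)) x y v b‖ : ℝ) : ℂ) := by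
          push_cast
          simp only [← hc2]
          rw [hB]
          simp only [matrixElement_apply, sum_apply, smul_apply, lp.coeFn_sum, Finset.sum_apply,
            lp.coeFn_smul, Pi.smul_apply]
          simp
        have h2 : ∑ i ∈ s, ‖matrixElement (spectralProjection H (T i)) x y v b‖
            = ‖matrixElement (borelFC H (fun t => ∑ i ∈ s, c i * (T i).indicator 1 t)) x y v b‖ := by
          rw [h1, Complex.norm_real, Real.norm_eq_abs,
            abs_of_nonneg (Finset.sum_nonneg fun _ _ => norm_nonneg _)]
        rw [h2]
        exact (PiLp.norm_apply_le _ b).trans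
          (ContinuousLinearMap.le_of_opNorm_le _ (hM _ hf) v)
    _ = N * (M * ‖v‖) := by simp

lemma one_add_norm_le (x y : ℤ × ℤ) : 1 + ‖y‖ ≤ (1 + ‖x‖) * (1 + ‖y - x‖) := by
  have : ‖y‖ ≤ ‖x‖ + ‖y - x‖ := by
    calc ‖y‖ = ‖x + (y - x)‖ := by congr 1; abel
      _ ≤ _ := norm_add_le _ _
  nlinarith [norm_nonneg x, norm_nonneg (y - x), mul_nonneg (norm_nonneg x) (norm_nonneg (y - x))]

/-- Spectral measures of site vectors are quantitatively pure point in a mobility gap. -/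
lemma IsMobilityGap.exists_measure_le_of_small_atoms (hΔ : IsMobilityGap H Δ) (x : ℤ × ℤ)
    (v : EuclideanSpace ℂ (Fin N)) :
    ∃ K : ℝ, 0 ≤ K ∧ ∀ δ : ℝ, 0 < δ → ∀ T, MeasurableSet T → T ⊆ gapInterior Δ →
      (∀ t ∈ T, spectralMeasure H (lp.single 2 x v) {t} < ENNReal.ofReal (δ ^ 2)) →
      spectralMeasure H (lp.single 2 x v) T ≤ ENNReal.ofReal (δ * K) := by
  obtain ⟨ν, -, hν⟩ := hΔ.exists_bound
  -- Of this decay, `ν` powers convert the growth in `y` into growth in the fixed site `x`; the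
  -- remaining 4 make the sum over `y` converge.
  obtain ⟨C, hC1, hC⟩ := hν (ν + 4)
  set e : BulkSpace N := lp.single 2 x v with he
  set D : ℝ := N * (C * (1 + ‖x‖) ^ ν * ‖v‖) with hD
  have hD0 : 0 ≤ D := by positivity
  have hbound : ∀ f ∈ borelOne Δ, ∀ y, ‖matrixElement (borelFC H f) y x‖
      ≤ C * (1 + ‖x‖) ^ ν * ((1 + ‖x - y‖) ^ 4)⁻¹ := by
    intro f hf y
    refine (hC f hf y x).trans ?_
    have h1 : (1 + ‖y‖) ^ ν ≤ (1 + ‖x‖) ^ ν * (1 + ‖y - x‖) ^ ν := by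
      rw [← mul_pow]; gcongr; exact one_add_norm_le x y
    rw [norm_sub_rev x y]
    have h2 : 0 < 1 + ‖y - x‖ := by positivity
    calc C * ((1 + ‖y - x‖) ^ (ν + 4))⁻¹ * (1 + ‖y‖) ^ ν
        ≤ C * ((1 + ‖y - x‖) ^ (ν + 4))⁻¹ * ((1 + ‖x‖) ^ ν * (1 + ‖y - x‖) ^ ν) := by gcongr
      _ = C * (1 + ‖x‖) ^ ν * ((1 + ‖y - x‖) ^ 4)⁻¹ := by
        rw [pow_add]; field_simp
  refine ⟨D * latticeSum, mul_nonneg hD0 (tsum_nonneg fun _ => by positivity), ?_⟩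
  intro δ hδ T hT hTΔ hat
  obtain ⟨A, hA, hAd, rfl, hAδ⟩ := exists_partition_measure_le (spectralMeasure H e) hT hat
    (by simpa using pow_pos hδ 2)
  rw [measure_iUnion hAd hA]
  refine ENNReal.tsum_le_of_sum_range_le fun n => ?_
  have hAΔ : ∀ i, A i ⊆ gapInterior Δ := fun i => (Set.subset_iUnion A i).trans hTΔ
  have hreal : ∀ i, spectralMeasure H e (A i)
      = ENNReal.ofReal (‖spectralProjection H (A i) e‖ ^ 2) := fun i => by
    rw [norm_spectralProjection_apply_sq (hA i), ofReal_measureReal]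
  have hsmall : ∀ i, ‖spectralProjection H (A i) e‖ ≤ δ := fun i => by
    have h := hAδ i
    rw [hreal, ENNReal.ofReal_le_ofReal_iff (by positivity)] at h
    exact (sq_le_sq₀ (norm_nonneg _) hδ.le).1 h
  simp only [hreal]
  rw [← ENNReal.ofReal_sum_of_nonneg fun _ _ => sq_nonneg _]
  refine ENNReal.ofReal_le_ofReal ?_
  have hs : HasSum (fun y => ∑ i ∈ Finset.range n, ‖spectralProjection H (A i) e y‖ ^ 2)
      (∑ i ∈ Finset.range n, ‖spectralProjection H (A i) e‖ ^ 2) :=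
    hasSum_sum fun i _ => norm_lp_sq _
  have hs2 : HasSum (fun y => δ * (D * ((1 + ‖x - y‖) ^ 4)⁻¹)) (δ * (D * latticeSum)) := by
    refine HasSum.mul_left _ (HasSum.mul_left _ ?_)
    exact (Equiv.subLeft x).hasSum_iff.2 summable_lattice_decay.hasSum
  refine hasSum_le (fun y => ?_) hs hs2
  have hsum := sum_norm_matrixElement_le (H := H) (Finset.range n) hA hAΔ hAd
    (fun f hf => hbound f hf y) v
  -- One factor of each square is at most `δ`; the other is summed over the pieces by the weakly
  -- local bound, uniformly in their number.
  calc ∑ i ∈ Finset.range n, ‖spectralProjection H (A i) e y‖ ^ 2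
      ≤ ∑ i ∈ Finset.range n, δ * ‖matrixElement (spectralProjection H (A i)) y x v‖ := by
        refine Finset.sum_le_sum fun i _ => ?_
        rw [sq, matrixElement_apply, ← he]
        refine mul_le_mul_of_nonneg_right ?_ (norm_nonneg _)
        exact (lp.norm_apply_le_norm (by simp) _ _).trans (hsmall i)
    _ ≤ δ * (N * (C * (1 + ‖x‖) ^ ν * ((1 + ‖x - y‖) ^ 4)⁻¹ * ‖v‖)) := by
        rw [← Finset.mul_sum]; gcongr
    _ = δ * (D * ((1 + ‖x - y‖) ^ 4)⁻¹) := by rw [hD]; ring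

lemma finite_inter_bounds {S Δ : Set ℝ} (hS : S ⊆ Δ) :
    (S ∩ (lowerBounds Δ ∪ upperBounds Δ)).Finite := by
  rw [Set.inter_union_distrib_left]
  refine Set.Finite.union (Set.Subsingleton.finite ?_) (Set.Subsingleton.finite ?_)
  · exact fun a ha b hb => le_antisymm (ha.2 (hS hb.1)) (hb.2 (hS ha.1))
  · exact fun a ha b hb => le_antisymm (hb.2 (hS ha.1)) (ha.2 (hS hb.1))

/-- Remove the endpoints of `Δ` that lie in `S` and the finitely many atoms of mass at least `δ²`,
with `δ` chosen so that `δ K ≤ η`. -/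
lemma IsMobilityGap.exists_finite_measure_diff_le (hΔ : IsMobilityGap H Δ) {S : Set ℝ}
    (hS : MeasurableSet S) (hSΔ : S ⊆ Δ) (x : ℤ × ℤ) (v : EuclideanSpace ℂ (Fin N)) {η : ℝ}
    (hη : 0 < η) : ∃ Λ : Set ℝ, Λ.Finite ∧ Λ ⊆ S ∧ S \ Λ ⊆ gapInterior Δ ∧
      spectralMeasure H (lp.single 2 x v) (S \ Λ) ≤ ENNReal.ofReal η := by
  obtain ⟨K, hK0, hK⟩ := hΔ.exists_measure_le_of_small_atoms x v
  set δ : ℝ := η / (K + 1) with hδ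
  have hδ0 : 0 < δ := by positivity
  set Λ₁ := {t : ℝ | ENNReal.ofReal (δ ^ 2) ≤ spectralMeasure H (lp.single 2 x v) {t}} with hΛ₁
  have hfin : Λ₁.Finite := finite_setOf_le_measure_singleton _ (by simpa using pow_pos hδ0 2)
  have hfin2 : (S ∩ (lowerBounds Δ ∪ upperBounds Δ) ∪ S ∩ Λ₁).Finite :=
    (finite_inter_bounds hSΔ).union (hfin.subset Set.inter_subset_right)
  have hsub : S \ (S ∩ (lowerBounds Δ ∪ upperBounds Δ) ∪ S ∩ Λ₁) ⊆ gapInterior Δ := fun t ht =>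
    ⟨hSΔ ht.1, fun h => ht.2 (Or.inl ⟨ht.1, h⟩)⟩
  refine ⟨_, hfin2, Set.union_subset Set.inter_subset_left Set.inter_subset_left, hsub, ?_⟩
  refine (hK δ hδ0 _ (hS.diff hfin2.measurableSet) hsub fun t ht => ?_).trans
    (ENNReal.ofReal_le_ofReal ?_)
  · by_contra h
    exact ht.2 (Or.inr ⟨ht.1, not_lt.1 h⟩)
  · rw [hδ, div_mul_eq_mul_div, div_le_iff₀ (by positivity)]
    nlinarith

end Localization

/-! ### Smallness of the commutator with the flux insertion. -/

section Commutator

variable {N : ℕ} {H : BulkSpace N →L[ℂ] BulkSpace N} {Δ : Set ℝ}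

lemma adjoint_matrixElement (A : BulkSpace N →L[ℂ] BulkSpace N) (x y : ℤ × ℤ) :
    ContinuousLinearMap.adjoint (matrixElement A x y) = matrixElement (star A) y x := by
  ext1 v
  refine ext_inner_left ℂ fun w => ?_
  rw [ContinuousLinearMap.adjoint_inner_right, matrixElement_apply, matrixElement_apply,
    ContinuousLinearMap.star_eq_adjoint]
  have h1 := lp.inner_single_right (𝕜 := ℂ) x v (A (lp.single 2 y w))
  have h2 := lp.inner_single_left (𝕜 := ℂ) y w (ContinuousLinearMap.adjoint A (lp.single 2 x v))
  rw [ContinuousLinearMap.adjoint_inner_right] at h2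
  exact h1.symm.trans h2

lemma norm_matrixElement_comm {A : BulkSpace N →L[ℂ] BulkSpace N} (hA : IsSelfAdjoint A)
    (x y : ℤ × ℤ) : ‖matrixElement A x y‖ = ‖matrixElement A y x‖ := by
  rw [← hA.star_eq, ← adjoint_matrixElement, hA.star_eq, LinearIsometryEquiv.norm_map]

lemma norm_matrixElement_le_sum (A : BulkSpace N →L[ℂ] BulkSpace N) (x y : ℤ × ℤ) :
    ‖matrixElement A x y‖ ≤ ∑ b, ‖A (lp.single 2 y (EuclideanSpace.single b (1 : ℂ)))‖ := by
  refine ContinuousLinearMap.opNorm_le_bound _ (Finset.sum_nonneg fun _ _ => norm_nonneg _)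
    fun v => ?_
  have hv : v = ∑ b, v b • EuclideanSpace.single b (1 : ℂ) := by
    ext b
    simp [Finset.sum_apply, Pi.single_apply]
  conv_lhs => rw [hv]
  rw [map_sum, Finset.sum_mul]
  refine (norm_sum_le _ _).trans (Finset.sum_le_sum fun b _ => ?_)
  rw [map_smul, norm_smul, mul_comm]
  exact mul_le_mul (norm_matrixElement_le_single A x y _) (PiLp.norm_apply_le v b) (norm_nonneg _)
    (norm_nonneg _)

/-- Interpolation between the trivial bound and the weakly local bound tames the growth. -/
lemma sq_mul_pow_le_of_weakly_local {p C d r : ℝ} {ν : ℕ} (hν : 1 ≤ ν) (hp0 : 0 ≤ p) (hp1 : p ≤ 1)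
    (hC : 1 ≤ C) (hd : 0 ≤ d) (hr : 0 ≤ r)
    (h : p ≤ C * ((1 + d) ^ (10 * ν))⁻¹ * (1 + r) ^ ν) : p ^ 2 * (1 + d) ^ 10 ≤ C * (1 + r) := by
  have hν0 : ν ≠ 0 := by omega
  -- Compare `ν`-th powers: as `p ≤ 1`, `p ^ (2ν) ≤ p`, to which the weakly local bound applies.
  refine (pow_le_pow_iff_left₀ (by positivity) (by positivity) hν0).1 ?_
  have h1 : (p ^ 2) ^ ν ≤ p := by
    rw [← pow_mul]
    exact pow_le_of_le_one hp0 hp1 (by omega)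
  have h2 : 0 < (1 + d) ^ (10 * ν) := by positivity
  calc (p ^ 2 * (1 + d) ^ 10) ^ ν = (p ^ 2) ^ ν * (1 + d) ^ (10 * ν) := by
        rw [mul_pow, ← pow_mul (1 + d)]
    _ ≤ (C * ((1 + d) ^ (10 * ν))⁻¹ * (1 + r) ^ ν) * (1 + d) ^ (10 * ν) := by
        gcongr; exact h1.trans h
    _ = C * (1 + r) ^ ν := by field_simp
    _ ≤ C ^ ν * (1 + r) ^ ν := by
        gcongr
        exact le_self_pow₀ hC hν0
    _ = (C * (1 + r)) ^ ν := (mul_pow _ _ _).symm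

/-- The phase difference gains `(1 + d) / (1 + r)`, while `p` costs only `(1 + r)^{1/2}`; the net
decay in `r` is a square root, and four powers of `1 + d` survive. -/
lemma norm_fluxPhase_sub_mul_le {p C : ℝ} {x y : ℤ × ℤ} (hp0 : 0 ≤ p) (hC : 1 ≤ C)
    (h : p ^ 2 * (1 + ‖x - y‖) ^ 10 ≤ C * (1 + ‖x‖)) :
    ‖fluxPhase x - fluxPhase y‖ * p ≤ 8 * √(C / (1 + ‖x‖)) * ((1 + ‖x - y‖) ^ 4)⁻¹ := by
  set d := ‖x - y‖ with hd
  set r := ‖x‖ with hr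
  have hd0 : 0 ≤ d := norm_nonneg _
  have hr0 : 0 ≤ r := norm_nonneg _
  set u := ‖fluxPhase x - fluxPhase y‖ with hu
  have hu0 : 0 ≤ u := norm_nonneg _
  have hur : u * (1 + r) ≤ 8 * (1 + d) :=
    (norm_fluxPhase_sub_le x y).trans (by rw [← hd]; linarith)
  have hdp : 0 < 1 + d := by positivity
  have hrp : 0 < 1 + r := by positivity
  have h1 : p * (1 + d) ^ 5 ≤ √(C * (1 + r)) := by
    refine Real.le_sqrt_of_sq_le ?_
    calc (p * (1 + d) ^ 5) ^ 2 = p ^ 2 * (1 + d) ^ 10 := by ring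
      _ ≤ _ := h
  have h2 : √(C * (1 + r)) = √(C / (1 + r)) * (1 + r) := by
    rw [← Real.sqrt_sq hrp.le, ← Real.sqrt_mul (by positivity), Real.sqrt_sq hrp.le]
    congr 1
    field_simp
  rw [h2] at h1
  rw [← div_eq_mul_inv, le_div_iff₀ (by positivity)]
  have h3 : (u * p * (1 + d) ^ 4) * ((1 + d) * (1 + r))
      ≤ (8 * √(C / (1 + r))) * ((1 + d) * (1 + r)) := by
    calc (u * p * (1 + d) ^ 4) * ((1 + d) * (1 + r))
        = (u * (1 + r)) * (p * (1 + d) ^ 5) := by ring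
      _ ≤ (8 * (1 + d)) * (√(C / (1 + r)) * (1 + r)) :=
          mul_le_mul hur h1 (by positivity) (by positivity)
      _ = _ := by ring
  exact le_of_mul_le_mul_right h3 (by positivity)

/-- Self-adjointness turns rows into columns, which are images of the finitely many basis vectors at
sites of `B`. The union of the exceptional sets of these vectors works for all of them at once. -/
lemma IsMobilityGap.exists_finite_row_le (hΔ : IsMobilityGap H Δ) {S : Set ℝ}
    (hS : MeasurableSet S) (hSΔ : S ⊆ Δ) (B : Finset (ℤ × ℤ)) {η : ℝ} (hη : 0 < η) :
    ∃ Λ : Set ℝ, Λ.Finite ∧ Λ ⊆ S ∧ S \ Λ ⊆ gapInterior Δ ∧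
      ∀ x ∈ B, ∀ y, ‖matrixElement (spectralProjection H (S \ Λ)) x y‖ ≤ η := by
  set ε : ℝ := η / (N + 1) with hε
  have hε0 : 0 < ε := by positivity
  choose Λ hΛf hΛS hΛΔ hΛ using fun (p : (ℤ × ℤ) × Fin N) =>
    hΔ.exists_finite_measure_diff_le hS hSΔ p.1 (EuclideanSpace.single p.2 (1 : ℂ))
      (pow_pos hε0 2)
  have hf2 : (S ∩ (lowerBounds Δ ∪ upperBounds Δ)).Finite := finite_inter_bounds hSΔ
  set Λ' : Set ℝ := (S ∩ (lowerBounds Δ ∪ upperBounds Δ)) ∪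
    ⋃ p ∈ B ×ˢ (Finset.univ : Finset (Fin N)), Λ p with hΛ'
  have hΛ'f : Λ'.Finite := hf2.union (Set.Finite.biUnion (Finset.finite_toSet _) fun p _ => hΛf p)
  have hm : MeasurableSet (S \ Λ') := hS.diff hΛ'f.measurableSet
  refine ⟨Λ', hΛ'f, Set.union_subset Set.inter_subset_left
    (Set.iUnion₂_subset fun p _ => hΛS p), fun t ht => ⟨hSΔ ht.1, fun h => ht.2 (Or.inl ⟨ht.1, h⟩)⟩,
    fun x hx y => ?_⟩
  rw [norm_matrixElement_comm (isStarProjection_spectralProjection hm).isSelfAdjoint]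
  refine (norm_matrixElement_le_sum _ _ _).trans ?_
  have hb : ∀ b : Fin N, ‖spectralProjection H (S \ Λ')
      (lp.single 2 x (EuclideanSpace.single b (1 : ℂ)))‖ ≤ ε := fun b => by
    refine (sq_le_sq₀ (norm_nonneg _) hε0.le).1 ?_
    rw [norm_spectralProjection_apply_sq hm]
    refine ENNReal.toReal_le_of_le_ofReal (by positivity) ((measure_mono ?_).trans (hΛ (x, b)))
    refine Set.sdiff_subset_sdiff_right ?_
    intro t ht
    exact Or.inr (Set.mem_iUnion₂.2 ⟨(x, b), by simp [hx], ht⟩)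
  refine (Finset.sum_le_sum fun b _ => hb b).trans ?_
  rw [Finset.sum_const, Finset.card_univ, Fintype.card_fin, nsmul_eq_mul, hε, mul_div_assoc',
    div_le_iff₀ (by positivity)]
  nlinarith

/-- Removing finitely many points from `S`, the commutator of the spectral projection with the
flux insertion becomes small. -/
theorem IsMobilityGap.exists_finite_norm_commutator_lt_one (hΔ : IsMobilityGap H Δ) {S : Set ℝ}
    (hS : MeasurableSet S) (hSΔ : S ⊆ Δ) :
    ∃ Λ : Set ℝ, Λ.Finite ∧ Λ ⊆ S ∧
      ‖spectralProjection H (S \ Λ) * fluxInsertion N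
        - fluxInsertion N * spectralProjection H (S \ Λ)‖ < 1 := by
  obtain ⟨ν, hν1, hν⟩ := hΔ.exists_bound
  obtain ⟨C, hC1, hC⟩ := hν (10 * ν)
  obtain ⟨D, hD1, hD⟩ := hν 8
  have hG : 0 ≤ latticeSum := tsum_nonneg fun _ => by positivity
  -- The radius is fixed before `Λ`, which is possible because `C` is uniform over `borelOne Δ`.
  obtain ⟨R, hR⟩ : ∃ R : ℝ, 0 < R ∧ 8 * √(C / (1 + R)) * latticeSum ≤ 1 / 2 := by
    have h1 : Tendsto (fun R : ℝ => 8 * √(C / (1 + R)) * latticeSum) atTop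
        (𝓝 (8 * √0 * latticeSum)) := by
      refine ((Real.continuous_sqrt.tendsto 0).comp ?_).const_mul 8 |>.mul_const _
      exact tendsto_const_nhds.div_atTop (tendsto_atTop_add_const_left _ _ tendsto_id)
    rw [Real.sqrt_zero, mul_zero, zero_mul] at h1
    exact ((eventually_gt_atTop 0).and (h1.eventually_le_const (by norm_num))).exists
  obtain ⟨hR0, hR⟩ := hR
  set b : ℝ := D * (1 + R) ^ ν with hb
  have hb0 : 0 < b := by positivity
  -- Chosen so that a near row sums to at most `2 s * latticeSum ≤ 1 / 2`.
  set s : ℝ := 1 / (4 * (latticeSum + 1)) with hs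
  have hs0 : 0 < s := by positivity
  have hball : (Metric.closedBall (0 : ℤ × ℤ) R).Finite :=
    (isCompact_closedBall (0 : ℤ × ℤ) R).finite_of_discrete
  obtain ⟨Λ, hΛf, hΛS, hΛΔ, hΛ⟩ := hΔ.exists_finite_row_le hS hSΔ hball.toFinset
    (show 0 < s ^ 2 / b by positivity)
  refine ⟨Λ, hΛf, hΛS, ?_⟩
  have hm : MeasurableSet (S \ Λ) := hS.diff hΛf.measurableSet
  set P := spectralProjection H (S \ Λ) with hP
  have hPp : IsStarProjection P := isStarProjection_spectralProjection hm
  have hPf : P = borelFC H ((S \ Λ).indicator 1) := rfl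
  have hPb := indicator_mem_borelOne hm hΛΔ
  refine (norm_le_of_symmetric_kernel _
    (fun x y => ‖fluxPhase x - fluxPhase y‖ * ‖matrixElement P x y‖)
    (fun x y => (norm_matrixElement_commutator_fluxInsertion P x y).le)
    (fun x y => by rw [norm_sub_rev, norm_matrixElement_comm hPp.isSelfAdjoint])
    (c := 1 / 2) fun x F => ?_).trans_lt (by norm_num)
  by_cases hx : ‖x‖ ≤ R
  · have hpt : ∀ y, ‖fluxPhase x - fluxPhase y‖ * ‖matrixElement P x y‖
        ≤ 2 * s * ((1 + ‖x - y‖) ^ 4)⁻¹ := by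
      intro y
      have h1 : ‖matrixElement P x y‖ ≤ s ^ 2 / b := hΛ x (by simpa using hx) y
      have h2 : ‖matrixElement P x y‖ ≤ b * ((1 + ‖x - y‖) ^ 8)⁻¹ := by
        refine (hD _ hPb x y).trans ?_
        rw [hb, mul_right_comm]
        gcongr
      -- Geometric mean of the uniform smallness `s² / b` and the decay bound with exponent 8.
      have h3 : ‖matrixElement P x y‖ ≤ s * ((1 + ‖x - y‖) ^ 4)⁻¹ := by
        refine (sq_le_sq₀ (norm_nonneg _) (by positivity)).1 ?_
        rw [sq]
        refine (mul_le_mul h1 h2 (norm_nonneg _) (by positivity)).trans_eq ?_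
        field_simp
      rw [mul_assoc]
      exact mul_le_mul (norm_fluxPhase_sub_le_two x y) h3 (norm_nonneg _) (by norm_num)
    refine (Finset.sum_le_sum fun y _ => hpt y).trans ?_
    rw [← Finset.mul_sum]
    refine (mul_le_mul_of_nonneg_left (sum_lattice_decay_le x F) (by positivity)).trans ?_
    rw [hs, mul_one_div, div_mul_eq_mul_div, div_le_iff₀ (by positivity)]
    linarith
  · push Not at hx
    have hpt : ∀ y, ‖fluxPhase x - fluxPhase y‖ * ‖matrixElement P x y‖
        ≤ 8 * √(C / (1 + R)) * ((1 + ‖x - y‖) ^ 4)⁻¹ := by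
      intro y
      refine (norm_fluxPhase_sub_mul_le (norm_nonneg _) hC1
        (sq_mul_pow_le_of_weakly_local hν1 (norm_nonneg _)
          ((norm_matrixElement_le P x y).trans hPp.norm_le) hC1 (norm_nonneg _) (norm_nonneg _)
          (hC _ hPb x y))).trans ?_
      gcongr
    refine (Finset.sum_le_sum fun y _ => hpt y).trans ?_
    rw [← Finset.mul_sum]
    exact (mul_le_mul_of_nonneg_left (sum_lattice_decay_le x F) (by positivity)).trans hR

end Commutator

/-! ### Conclusion, with the splitting of `S` into `S \ Λ` and `Λ`. -/

theorem mainTheorem4 (N : ℕ) (H : BulkSpace N →L[ℂ] BulkSpace N) (Δ : Set ℝ)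
    (hΔ : IsMobilityGap H Δ) (S : Set ℝ) (hS : MeasurableSet S) (hSΔ : S ⊆ Δ) :
    (projCompression (spectralProjection H S) (fluxInsertion N)).IsFredholm ∧
    fredholmIndex (projCompression (spectralProjection H S) (fluxInsertion N)) = 0 ∧
    ∀ Θ : BulkSpace N →ₗ⋆[ℂ] BulkSpace N, IsTimeReversal Θ → IsTimeReversalInvariant Θ H →
      IsThetaOdd Θ (projCompression (spectralProjection H S) (fluxInsertion N)) ∧
      fredholmIndexTwo (projCompression (spectralProjection H S) (fluxInsertion N)) = 0 := by
  have hH : IsSelfAdjoint H := hΔ.isHamiltonian.selfAdjoint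
  obtain ⟨Λ, hΛf, hΛS, hΛ⟩ := hΔ.exists_finite_norm_commutator_lt_one hS hSΔ
  have hΛm : MeasurableSet Λ := hΛf.measurableSet
  have hm : MeasurableSet (S \ Λ) := hS.diff hΛm
  have hQ : spectralProjection H S = spectralProjection H (S \ Λ) + spectralProjection H Λ := by
    rw [← spectralProjection_union hm hΛm Set.disjoint_sdiff_left, Set.sdiff_union_of_subset hΛS]
  have hP := isStarProjection_spectralProjection (H := H) hm
  have hR := isStarProjection_spectralProjection (H := H) hΛm
  have hPR := spectralProjection_mul_of_disjoint (H := H) hm hΛm Set.disjoint_sdiff_left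
  have hU := fluxInsertion_mem_unitary (N := N)
  have hfin := finiteDimensional_range_spectralProjection hH hΛf fun t ht =>
    hΔ.finite_multiplicity t (hSΔ (hΛS ht))
  obtain ⟨h1, h2⟩ := isFredholm_projCompression hP hR hPR hU hΛ
  rw [← hQ] at h1 h2
  refine ⟨h1, h2, fun Θ hΘ hΘH => ?_⟩
  have hodd := isThetaOdd_projCompression hΘ.isQuaternionic
    (isStarProjection_spectralProjection (H := H) hS)
    (hΘ.isQuaternionic.commute_spectralProjection hH hΘH hS) hΘ.star_fluxInsertion
  refine ⟨hodd, fredholmIndexTwo_eq_zero_of_schur hΘ.isQuaternionic hodd hR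
    (hΘ.isQuaternionic.commute_spectralProjection hH hΘH hΛm) ?_⟩
  rw [hQ]
  exact isUnit_schur hP hR hPR hU hΛ
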